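/- For $n\ge 1$ consider the zero-field isotropic Ising model on the periodic $n\times n\times n$ cubic lattice $\mathbb{Z}_n^3$ with $N=n^3$ sites: spins $\sigma_i=\pm1$, energy $\mathcal{H}_N=-J\sum_{\langle i,j\rangle}\sigma_i\sigma_j$, where the sum runs over all unordered pairs of distinct sites whose difference modulo $n$ is plus or minus a coordinate unit vector, and partition function $Z_N=\sum_{\{\sigma\}}\mathrm{e}^{-\beta\mathcal{H}_N}$. For real $\beta,J$ let $\beta f_N=-\frac1N\log Z_N$ be the reduced free energy per site, and $\beta f=\lim_{n\to\infty}\beta f_{n^3}$ its thermodynamic limit. Put $r=(\sqrt3-\sqrt2)(\sqrt2-1)$, $K_0=\arctan r$, and $t=\tanh(\beta J)$. Then the limit $\beta f$ exists for all real $\beta,J$ with $|t|<r$ (in particular for $|\beta J|<K_0$). For every $N=n^3$, and for $N=\infty$, there are power series with real coefficients $$\beta f_N=\sum_{k\ge0}b_{N,k}(\beta J)^k\quad(|\beta J|<K_0),\qquad \beta f_N=\sum_{k\ge0}a_{N,k}\,t^k\quad(|t|<r),$$ with radii of convergence at least $K_0$ and $r$ respectively, so that $\beta f_N$ and $\beta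 f$ extend to analytic functions $F_N$ of complex $\beta J$ in $|\beta J|<K_0$ and $G_N$ of complex $t$ in $|t|<r$. These satisfy $F_N(K)=G_N(\tanh K)$ (where $|\tanh K|<r$) for complex $|K|<K_0$. For finite $N$ and complex $\beta,J$ they are branches of $-\frac1N\log Z_N$: $\mathrm{e}^{-NF_N(\beta J)}=Z_N$ if $|\beta J|<K_0$, and $\mathrm{e}^{-NG_N(\tanh(\beta J))}=Z_N$ if $|\tanh(\beta J)|<r$ and $|\mathrm{Im}(\beta J)|<\pi/2$. For every $\rho<K_0$ (respectively $\rho<r$) the partial sums of the series in $\beta J$ (respectively $t$) converge uniformly, jointly in the variable in the closed complex disk of radius $\rho$ and in the size $N=n^3$, including $N=\infty$. Finally, for $N=n^3$ the coefficients of both series beyond the constant term agree with those for $N=\infty$ up to order $n-1$, and so do the constant terms: $b_{N,k}=b_{\infty,k}$ and $a_{N,k}=a_{\infty,k}$ for $0\le k\le n-1$. -/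

import Mathlib

open Filter Topology

noncomputable section

namespace CubicIsing

/-- The sites of the periodic `n × n × n` cubic lattice. -/
abbrev Site (n : ℕ) : Type := Fin 3 → ZMod n

/-- The nearest-neighbour graph of the periodic `n × n × n` cubic lattice: two (distinct) sites are
adjacent iff their difference is plus or minus a coordinate unit vector modulo `n`. -/
def torusGraph (n : ℕ) : SimpleGraph (Site n) where
  Adj i j := i ≠ j ∧ ∃ k : Fin 3, i - j = Pi.single k 1 ∨ i - j = -Pi.single k 1
  symm := ⟨fun i j h => by
    obtain ⟨hne, k, hk | hk⟩ := h
    · exact ⟨hne.symm, k, Or.inr (by rw [← hk, neg_sub])⟩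
    · exact ⟨hne.symm, k, Or.inl (by rw [← neg_sub, hk, neg_neg])⟩⟩
  loopless := ⟨fun _ h => h.1 rfl⟩

instance (n : ℕ) : DecidableRel (torusGraph n).Adj := fun i j =>
  inferInstanceAs (Decidable
    (i ≠ j ∧ ∃ k : Fin 3, i - j = Pi.single k 1 ∨ i - j = -Pi.single k 1))

/-- A spin configuration assigns `1` or `-1` to every site. -/
abbrev Config (n : ℕ) : Type := Site n → ℤˣ

/-- The spin at the site `i`, as an element of the ring `R`. -/
def spin (R : Type*) [CommRing R] {n : ℕ} (σ : Config n) (i : Site n) : R := ((σ i : ℤ) : R)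

/-- The interaction energy `H_N = -J ∑_{⟨i,j⟩} σ_i σ_j - B ∑_i σ_i`; the first sum runs over the
unordered nearest-neighbour pairs. It is used for real and for complex `J`, `B`. -/
def energy {R : Type*} [CommRing R] (n : ℕ) [NeZero n] (J B : R) (σ : Config n) : R :=
  -J * ∑ e ∈ (torusGraph n).edgeFinset, (e.map (spin R σ)).mul - B * ∑ i : Site n, spin R σ i

/-- The partition function `Z_N`, `N = n ^ 3`, for complex parameters. -/
def partitionFunction (n : ℕ) [NeZero n] (β J B : ℂ) : ℂ :=
  ∑ σ : Config n, Complex.exp (-β * energy n J B σ)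

/-- The partition function `Z_N`, `N = n ^ 3`, for real parameters. -/
def realPartitionFunction (n : ℕ) [NeZero n] (β J B : ℝ) : ℝ :=
  ∑ σ : Config n, Real.exp (-β * energy n J B σ)

/-- The reduced free energy per site `β f_N = -(1 / N) log Z_N`, `N = n ^ 3`, for real
parameters. -/
def finiteReducedFreeEnergy (n : ℕ) [NeZero n] (β J B : ℝ) : ℝ :=
  -(1 / (n : ℝ) ^ 3) * Real.log (realPartitionFunction n β J B)

/-- The reduced free energy per site, of the periodic `n × n × n` lattice at `n`, and its
thermodynamic limit at `⊤`. -/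
def reducedFreeEnergy : WithTop ℕ+ → ℝ → ℝ → ℝ → ℝ
  | (n : ℕ+) => fun β J B => finiteReducedFreeEnergy n β J B
  | ⊤ => fun β J B => limUnder (atTop : Filter ℕ+) fun n => finiteReducedFreeEnergy n β J B

/-- The radius `(√3 - √2)(√2 - 1)` in the variable `t = tanh (β J)`. -/
def tRadius : ℝ := (√3 - √2) * (√2 - 1)

/-- The radius `arctan ((√3 - √2)(√2 - 1))` in the variable `β J`. -/
def kRadius : ℝ := Real.arctan tRadius

end CubicIsing

end

namespace CubicIsing

noncomputable section

/-! ### Spin systems on a finite graph -/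

section Graph

open Finset

variable {V : Type*}

/-- The complex value of the spin at `i`. -/
def cspin (σ : V → ℤˣ) (i : V) : ℂ := ((σ i : ℤ) : ℂ)

lemma cspin_eq_one_or (σ : V → ℤˣ) (i : V) : cspin σ i = 1 ∨ cspin σ i = -1 := by
  rcases Int.units_eq_one_or (σ i) with h | h <;> simp [cspin, h]

@[simp] lemma cspin_mul_self (σ : V → ℤˣ) (i : V) : cspin σ i * cspin σ i = 1 := by
  rcases cspin_eq_one_or σ i with h | h <;> simp [h]

lemma cspin_sq (σ : V → ℤˣ) (i : V) : cspin σ i ^ 2 = 1 := by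
  rw [sq, cspin_mul_self]

@[simp] lemma norm_cspin (σ : V → ℤˣ) (i : V) : ‖cspin σ i‖ = 1 := by
  rcases cspin_eq_one_or σ i with h | h <;> simp [h]

/-- The product of the spins in `A`. -/
def character (A : Finset V) (σ : V → ℤˣ) : ℂ := ∏ i ∈ A, cspin σ i

@[simp] lemma character_empty (σ : V → ℤˣ) : character ∅ σ = 1 := by simp [character]

@[simp] lemma norm_character (A : Finset V) (σ : V → ℤˣ) : ‖character A σ‖ = 1 := by
  simp [character, norm_prod]

variable [DecidableEq V]

lemma prod_symmDiff_of_mul_self {ι : Type*} [DecidableEq ι] (A B : Finset ι) (f : ι → ℂ)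
    (hf : ∀ i, f i * f i = 1) :
    ∏ i ∈ symmDiff A B, f i = (∏ i ∈ A, f i) * ∏ i ∈ B, f i := by
  have h1 : symmDiff A B = (A \ B) ∪ (B \ A) := rfl
  rw [h1, prod_union (disjoint_sdiff_sdiff), ← sdiff_union_inter A B]
  conv_rhs => rw [prod_union (disjoint_sdiff_inter A B), ← sdiff_union_inter B A,
    prod_union (disjoint_sdiff_inter B A), inter_comm B A]
  have h2 : (∏ i ∈ A ∩ B, f i) * ∏ i ∈ A ∩ B, f i = 1 := by
    rw [← prod_mul_distrib]; exact prod_eq_one fun i _ => hf i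
  rw [sdiff_union_inter A B]
  have h3 : A \ B ∪ A ∩ B = A := sdiff_union_inter A B
  have h4 : B \ A ∪ A ∩ B = B := by rw [inter_comm]; exact sdiff_union_inter B A
  rw [h4]
  linear_combination (-(∏ i ∈ A \ B, f i) * ∏ i ∈ B \ A, f i) * h2

lemma character_symmDiff (A B : Finset V) (σ : V → ℤˣ) :
    character (symmDiff A B) σ = character A σ * character B σ :=
  prod_symmDiff_of_mul_self A B _ fun i => cspin_mul_self σ i

variable [Fintype V]

/-- `f` lies in the dual of the Fourier sup norm with norm at most `c`: an upper bound for the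
sum of the absolute values of the Fourier coefficients of `f`. -/
def WienerBound (c : ℝ) (f : (V → ℤˣ) → ℂ) : Prop :=
  ∀ (w : (V → ℤˣ) → ℂ) (M : ℝ), (∀ A, ‖∑ σ, character A σ * w σ‖ ≤ M) → ‖∑ σ, f σ * w σ‖ ≤ c * M

lemma WienerBound.character_mul {c : ℝ} {f : (V → ℤˣ) → ℂ} (hf : WienerBound c f)
    (A : Finset V) : WienerBound c fun σ => character A σ * f σ := by
  intro w M hM
  have := hf (fun σ => character A σ * w σ) M fun B => by
    have := hM (symmDiff B A)
    simpa only [character_symmDiff, mul_assoc] using this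
  have e : ∀ σ, character A σ * f σ * w σ = f σ * (character A σ * w σ) := fun σ => by ring
  simpa only [e] using this

lemma WienerBound.mul {c d : ℝ} {f g : (V → ℤˣ) → ℂ} (hf : WienerBound c f)
    (hg : WienerBound d g) : WienerBound (c * d) fun σ => f σ * g σ := by
  intro w M hM
  have := hf (fun σ => g σ * w σ) (d * M) fun A => by
    have := hg.character_mul A w M hM
    simpa only [mul_assoc] using this
  simpa only [mul_assoc] using this

lemma wienerBound_zero : WienerBound (V := V) 0 fun _ => 0 := by
  intro w M _
  simp

lemma wienerBound_character (A : Finset V) : WienerBound 1 (character A) := by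
  intro w M hM
  simpa using hM A

lemma wienerBound_one : WienerBound (V := V) 1 fun _ => 1 := by
  have h : character (∅ : Finset V) = fun _ => 1 := by ext; simp
  exact h ▸ wienerBound_character ∅

lemma wienerBound_cspin (i : V) : WienerBound 1 fun σ => cspin σ i := by
  have h : character ({i} : Finset V) = fun σ => cspin σ i := by ext; simp [character]
  exact h ▸ wienerBound_character {i}

lemma WienerBound.const_mul {c : ℝ} {f : (V → ℤˣ) → ℂ} (hf : WienerBound c f)
    (a : ℂ) : WienerBound (‖a‖ * c) fun σ => a * f σ := by
  intro w M hM
  simp only [mul_assoc, ← mul_sum, norm_mul]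
  exact mul_le_mul_of_nonneg_left (hf w M hM) (norm_nonneg _)

lemma WienerBound.add {c d : ℝ} {f g : (V → ℤˣ) → ℂ} (hf : WienerBound c f)
    (hg : WienerBound d g) : WienerBound (c + d) fun σ => f σ + g σ := by
  intro w M hM
  simp only [add_mul, sum_add_distrib]
  exact (norm_add_le _ _).trans (add_le_add (hf w M hM) (hg w M hM))

lemma WienerBound.norm_le {c : ℝ} {f : (V → ℤˣ) → ℂ} (hf : WienerBound c f) (σ : V → ℤˣ) :
    ‖f σ‖ ≤ c := by
  have := hf (fun τ => if τ = σ then 1 else 0) 1 fun A => by simp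
  simpa using this

/-- A division in the Wiener algebra. -/
lemma WienerBound.div_one_add {c d : ℝ} {f g : (V → ℤˣ) → ℂ} (hf : WienerBound c f)
    (hg : WienerBound d g) (hd : d < 1) :
    (∀ σ, 1 + g σ ≠ 0) ∧ WienerBound (c / (1 - d)) fun σ => f σ / (1 + g σ) := by
  have h0 : ∀ σ, 1 + g σ ≠ 0 := fun σ h => by
    have h1 := hg.norm_le σ
    rw [show g σ = -1 by linear_combination h] at h1
    norm_num at h1; linarith
  refine ⟨h0, fun w M hM => ?_⟩
  set h : (V → ℤˣ) → ℂ := fun σ => f σ / (1 + g σ) with hh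
  have hrec : ∀ σ, h σ = f σ - g σ * h σ := fun σ => by
    rw [hh]; field_simp [h0 σ]; ring
  obtain ⟨B, -, hB⟩ := exists_max_image (univ : Finset (Finset V))
    (fun A => ‖∑ σ, character A σ * (h σ * w σ)‖) univ_nonempty
  set Q := ‖∑ σ, character B σ * (h σ * w σ)‖
  have key : Q ≤ c * M + d * Q := by
    have e : ∑ σ, character B σ * (h σ * w σ) =
        ∑ σ, (character B σ * f σ) * w σ - ∑ σ, (character B σ * g σ) * (h σ * w σ) := by
      rw [← sum_sub_distrib]
      refine sum_congr rfl fun σ _ => ?_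
      conv_lhs => rw [hrec σ]
      ring
    calc Q = ‖∑ σ, (character B σ * f σ) * w σ - ∑ σ, (character B σ * g σ) * (h σ * w σ)‖ := by
          rw [← e]
      _ ≤ _ := (norm_sub_le _ _).trans (add_le_add (hf.character_mul B w M hM)
          (hg.character_mul B _ Q fun A => hB A (mem_univ _)))
  have h2 : ‖∑ σ, h σ * w σ‖ ≤ Q := by simpa using hB ∅ (mem_univ _)
  refine h2.trans ?_
  rw [div_mul_eq_mul_div, le_div_iff₀ (by linarith)]
  linarith

/-- `tanh (K ∑ σ_b)`, `b ∈ S`, in terms of `t = tanh K`. -/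
def tanhSum (t : ℂ) (S : Finset V) (σ : V → ℤˣ) : ℂ :=
  (∏ b ∈ S, (1 + t * cspin σ b) - ∏ b ∈ S, (1 - t * cspin σ b)) /
    (∏ b ∈ S, (1 + t * cspin σ b) + ∏ b ∈ S, (1 - t * cspin σ b))

omit [Fintype V] [DecidableEq V] in
lemma _root_.Real.tan_nat_mul_lt_one {θ : ℝ} (h0 : 0 ≤ θ) {k : ℕ} (hk : k * θ < Real.pi / 4) :
    0 ≤ Real.tan (k * θ) ∧ Real.tan (k * θ) < 1 := by
  have hpi := Real.pi_pos
  have h1 : 0 ≤ k * θ := by positivity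
  refine ⟨Real.tan_nonneg_of_nonneg_of_le_pi_div_two h1 (by linarith), ?_⟩
  rw [← Real.tan_pi_div_four]
  exact Real.tan_lt_tan_of_nonneg_of_lt_pi_div_two h1 (by linarith) hk

lemma wienerBound_tanhSum {t : ℂ} {θ : ℝ} (h0 : 0 ≤ θ) (ht : ‖t‖ = Real.tan θ) (S : Finset V)
    (hS : #S * θ < Real.pi / 4) :
    (∀ σ, ∏ b ∈ S, (1 + t * cspin σ b) + ∏ b ∈ S, (1 - t * cspin σ b) ≠ 0) ∧
      WienerBound (Real.tan (#S * θ)) (tanhSum t S) := by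
  induction S using Finset.induction_on with
  | empty =>
    refine ⟨fun σ => by norm_num, ?_⟩
    have : tanhSum t (∅ : Finset V) = fun _ => 0 := by ext; simp [tanhSum]
    rw [this]; simpa using wienerBound_zero
  | insert a S ha ih =>
    rw [card_insert_of_notMem ha] at hS ⊢
    have hS' : (#S : ℝ) * θ < Real.pi / 4 := by push_cast at hS; linarith
    obtain ⟨hne, hb⟩ := ih hS'
    obtain ⟨u0, u1⟩ := Real.tan_nat_mul_lt_one h0 hS'
    obtain ⟨v0, v1⟩ := Real.tan_nat_mul_lt_one (k := 1) h0 (by push_cast at hS ⊢; nlinarith)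
    rw [Nat.cast_one, one_mul] at v0 v1
    have hnum := hb.add ((wienerBound_cspin a).const_mul t)
    have hden := ((wienerBound_cspin a).const_mul t).mul hb
    have hlt : ‖t‖ * 1 * Real.tan (#S * θ) < 1 := by rw [ht]; nlinarith
    obtain ⟨hd0, hd⟩ := hnum.div_one_add hden hlt
    have htan : Real.tan ((#S + 1 : ℕ) * θ) =
        (Real.tan (#S * θ) + ‖t‖ * 1) / (1 - ‖t‖ * 1 * Real.tan (#S * θ)) := by
      have hpi := Real.pi_pos
      have a1 : (#S : ℝ) * θ ≥ 0 := by positivity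
      push_cast at hS ⊢
      rw [add_mul, one_mul, Real.tan_add, ht]
      · ring
      · left
        constructor
        · intro k hk
          rcases le_or_gt k (-1) with hk' | hk'
          · have : (k : ℝ) ≤ -1 := by exact_mod_cast hk'
            nlinarith
          · have : (0 : ℝ) ≤ k := by exact_mod_cast (by omega : (0:ℤ) ≤ k)
            nlinarith
        · intro k hk
          rcases le_or_gt k (-1) with hk' | hk'
          · have : (k : ℝ) ≤ -1 := by exact_mod_cast hk'
            nlinarith
          · have : (0 : ℝ) ≤ k := by exact_mod_cast (by omega : (0:ℤ) ≤ k)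
            nlinarith
    have hdef : ∀ σ, ∏ b ∈ insert a S, (1 + t * cspin σ b) + ∏ b ∈ insert a S, (1 - t * cspin σ b)
        = (1 + t * cspin σ a * tanhSum t S σ) *
          (∏ b ∈ S, (1 + t * cspin σ b) + ∏ b ∈ S, (1 - t * cspin σ b)) := fun σ => by
      have := hne σ
      rw [prod_insert ha, prod_insert ha, tanhSum]
      field_simp
      ring
    refine ⟨fun σ => ?_, ?_⟩
    · rw [hdef]; exact mul_ne_zero (hd0 σ) (hne σ)
    · rw [htan]
      convert hd using 2 with σ
      have h1 := hne σ
      have h2 := hd0 σ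
      rw [tanhSum, hdef, prod_insert ha, prod_insert ha]
      rw [div_eq_div_iff (mul_ne_zero h2 h1) h2]
      rw [tanhSum]
      field_simp
      ring

/-- Flip the spin at `i`. -/
def flipAt (i : V) (σ : V → ℤˣ) : V → ℤˣ := Function.update σ i (-σ i)

omit [Fintype V] in
lemma cspin_flipAt_self (i : V) (σ : V → ℤˣ) : cspin (flipAt i σ) i = -cspin σ i := by
  simp [cspin, flipAt]

omit [Fintype V] in
lemma cspin_flipAt_of_ne {i j : V} (h : j ≠ i) (σ : V → ℤˣ) :
    cspin (flipAt i σ) j = cspin σ j := by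
  simp [cspin, flipAt, h]

omit [Fintype V] in
lemma flipAt_flipAt (i : V) (σ : V → ℤˣ) : flipAt i (flipAt i σ) = σ := by
  simp [flipAt]

lemma sum_eq_zero_of_flipAt (i : V) (f : (V → ℤˣ) → ℂ)
    (h : ∀ σ, f (flipAt i σ) = -f σ) : ∑ σ, f σ = 0 := by
  have : ∑ σ, f σ = ∑ σ, f (flipAt i σ) :=
    (Equiv.sum_comp (Function.Involutive.toPerm (flipAt i) (flipAt_flipAt i)) f).symm
  simp only [h, sum_neg_distrib] at this
  linear_combination this / 2

variable (G : SimpleGraph V) [DecidableRel G.Adj]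

/-- The product of the two spins of a bond. -/
def bond (σ : V → ℤˣ) (e : Sym2 V) : ℂ := (e.map (cspin σ)).mul

omit [DecidableEq V] [Fintype V] in
@[simp] lemma bond_mk (σ : V → ℤˣ) (i j : V) : bond σ s(i, j) = cspin σ i * cspin σ j := by
  simp [bond]

omit [DecidableEq V] [Fintype V] in
lemma bond_mul_self (σ : V → ℤˣ) (e : Sym2 V) : bond σ e * bond σ e = 1 := by
  induction e with
  | _ i j =>
    rw [bond_mk]
    linear_combination cspin_mul_self σ i * cspin σ j * cspin σ j + cspin_mul_self σ j

/-- The high-temperature weight of a spin configuration. -/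
def weight (t : ℂ) (σ : V → ℤˣ) : ℂ := ∏ e ∈ G.edgeFinset, (1 + t * bond σ e)

/-- The unnormalized expectation of the observable `f`. -/
def gibbsSum (f : (V → ℤˣ) → ℂ) (t : ℂ) : ℂ := ∑ σ, f σ * weight G t σ

/-- The part of the weight that does not involve the spin at `i`. -/
def restWeight (i : V) (t : ℂ) (σ : V → ℤˣ) : ℂ :=
  ∏ e ∈ G.edgeFinset with ¬ i ∈ e, (1 + t * bond σ e)

lemma restWeight_flipAt (i : V) (t : ℂ) (σ : V → ℤˣ) :
    restWeight G i t (flipAt i σ) = restWeight G i t σ := by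
  refine prod_congr rfl fun e he => ?_
  have he' := (mem_filter.1 he).2
  induction e with
  | _ j k =>
    simp only [Sym2.mem_iff, not_or] at he'
    rw [bond_mk, bond_mk, cspin_flipAt_of_ne (Ne.symm he'.1), cspin_flipAt_of_ne (Ne.symm he'.2)]

@[to_additive]
lemma prod_filter_mem_edgeFinset {M : Type*} [CommMonoid M] (i : V) (f : Sym2 V → M) :
    ∏ e ∈ G.edgeFinset with i ∈ e, f e = ∏ b ∈ G.neighborFinset i, f s(i, b) := by
  symm
  refine prod_nbij (fun b => s(i, b)) ?_ ?_ ?_ ?_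
  · intro b hb
    simpa using hb
  · intro b _ c _ h
    exact Sym2.congr_right.1 h
  · intro e he
    induction e with
    | _ j k =>
      simp only [coe_filter, SimpleGraph.mem_edgeFinset, SimpleGraph.mem_edgeSet, Sym2.mem_iff,
        Set.mem_ofPred_eq] at he
      obtain ⟨h, rfl | rfl⟩ := he
      · exact ⟨k, by simpa using h, rfl⟩
      · exact ⟨j, by simpa using h.symm, Sym2.eq_swap⟩
  · intro b _
    rfl

lemma sum_sum_neighborFinset (f : Sym2 V → ℂ) :
    ∑ i, ∑ b ∈ G.neighborFinset i, f s(i, b) = 2 * ∑ e ∈ G.edgeFinset, f e := by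
  simp only [← sum_filter_mem_edgeFinset, sum_filter]
  rw [sum_comm, mul_sum]
  refine sum_congr rfl fun e he => ?_
  rw [← sum_filter, sum_const]
  induction e with
  | _ j k =>
    have hjk : j ≠ k := G.ne_of_adj (by simpa using he)
    have : ({i | i ∈ s(j, k)} : Finset V) = {j, k} := by ext; simp
    rw [this, card_pair hjk]
    simp

lemma weight_eq (i : V) (t : ℂ) (σ : V → ℤˣ) :
    weight G t σ =
      (∏ b ∈ G.neighborFinset i, (1 + t * (cspin σ i * cspin σ b))) * restWeight G i t σ := by
  rw [weight, restWeight, ← prod_filter_mul_prod_filter_not G.edgeFinset (fun e => i ∈ e)]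
  rw [prod_filter_mem_edgeFinset]
  simp only [bond_mk]

/-- The spin at `i` may be replaced by its conditional expectation. -/
lemma gibbsSum_cspin_mul {t : ℂ} (i : V) (f : (V → ℤˣ) → ℂ)
    (hf : ∀ σ, f (flipAt i σ) = f σ)
    (hne : ∀ σ : V → ℤˣ, ∏ b ∈ G.neighborFinset i, (1 + t * cspin σ b) +
      ∏ b ∈ G.neighborFinset i, (1 - t * cspin σ b) ≠ 0) :
    gibbsSum G (fun σ => f σ * cspin σ i) t =
      gibbsSum G (fun σ => f σ * tanhSum t (G.neighborFinset i) σ) t := by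
  rw [← sub_eq_zero, gibbsSum, gibbsSum, ← sum_sub_distrib]
  refine sum_eq_zero_of_flipAt i _ fun σ => ?_
  have hb : ∀ b ∈ G.neighborFinset i, cspin (flipAt i σ) b = cspin σ b := fun b hb =>
    cspin_flipAt_of_ne (by rintro rfl; simp at hb) σ
  have hP : ∏ b ∈ G.neighborFinset i, (1 + t * cspin (flipAt i σ) b) =
      ∏ b ∈ G.neighborFinset i, (1 + t * cspin σ b) :=
    prod_congr rfl fun b h => by rw [hb b h]
  have hM : ∏ b ∈ G.neighborFinset i, (1 - t * cspin (flipAt i σ) b) =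
      ∏ b ∈ G.neighborFinset i, (1 - t * cspin σ b) :=
    prod_congr rfl fun b h => by rw [hb b h]
  have hT : tanhSum t (G.neighborFinset i) (flipAt i σ) = tanhSum t (G.neighborFinset i) σ := by
    rw [tanhSum, tanhSum, hP, hM]
  have hX : ∏ b ∈ G.neighborFinset i, (1 + t * (cspin (flipAt i σ) i * cspin (flipAt i σ) b)) =
      ∏ b ∈ G.neighborFinset i, (1 + t * (-cspin σ i * cspin σ b)) :=
    prod_congr rfl fun b h => by rw [hb b h, cspin_flipAt_self]
  rw [weight_eq G i t, weight_eq G i t, restWeight_flipAt, hf, hT, hX, cspin_flipAt_self]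
  have h0 := hne σ
  rcases cspin_eq_one_or σ i with h | h
  · simp only [h, one_mul, neg_mul, mul_neg, ← sub_eq_add_neg]
    rw [tanhSum]
    field_simp
    ring
  · simp only [h, one_mul, neg_mul, mul_neg, neg_neg, ← sub_eq_add_neg]
    rw [tanhSum]
    field_simp
    ring

lemma norm_gibbsSum_character_le {t : ℂ} {θ : ℝ} (h0 : 0 ≤ θ) (ht : ‖t‖ = Real.tan θ) {d : ℕ}
    (hG : ∀ i, G.degree i ≤ d) (hd : d * θ < Real.pi / 4) {A : Finset V} (hA : A.Nonempty) {M : ℝ}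
    (hM : ∀ B, ‖gibbsSum G (character B) t‖ ≤ M) :
    ‖gibbsSum G (character A) t‖ ≤ Real.tan (d * θ) * M := by
  obtain ⟨i, hi⟩ := hA
  have hle : (#(G.neighborFinset i) : ℝ) * θ ≤ d * θ := by
    gcongr
    simpa using hG i
  obtain ⟨hne, hb⟩ := wienerBound_tanhSum h0 ht (G.neighborFinset i) (hle.trans_lt hd)
  have e : character A = fun σ => character (A.erase i) σ * cspin σ i := by
    ext σ
    rw [character, character, prod_erase_mul _ _ hi]
  rw [e, gibbsSum_cspin_mul G i _ _ hne]
  · have := hb.character_mul (A.erase i) (weight G t) M hM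
    refine this.trans (mul_le_mul_of_nonneg_right ?_ ((norm_nonneg _).trans (hM ∅)))
    have hpi := Real.pi_pos
    have h1 : (0:ℝ) ≤ (#(G.neighborFinset i) : ℝ) * θ := by positivity
    exact Real.strictMonoOn_tan.monotoneOn ⟨by linarith, by linarith⟩
      ⟨by linarith, by linarith⟩ hle
  · intro σ
    exact prod_congr rfl fun b hb => cspin_flipAt_of_ne (ne_of_mem_erase hb) σ

lemma norm_gibbsSum_character_le_partition {t : ℂ} {θ : ℝ} (h0 : 0 ≤ θ) (ht : ‖t‖ = Real.tan θ)
    {d : ℕ} (hG : ∀ i, G.degree i ≤ d) (hd : d * θ < Real.pi / 4) (A : Finset V) :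
    ‖gibbsSum G (character A) t‖ ≤ ‖gibbsSum G (fun _ => 1) t‖ := by
  obtain ⟨B, -, hB⟩ := exists_max_image (univ : Finset (Finset V))
    (fun A => ‖gibbsSum G (character A) t‖) univ_nonempty
  refine (hB A (mem_univ _)).trans ?_
  rcases B.eq_empty_or_nonempty with rfl | hne
  · have : character (∅ : Finset V) = fun _ => 1 := by ext; simp
    rw [this]
  · have h1 := norm_gibbsSum_character_le G h0 ht hG hd hne fun A => hB A (mem_univ _)
    have h2 := Real.tan_nat_mul_lt_one h0 hd
    have h3 := norm_nonneg (gibbsSum G (character B) t)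
    have h4 : ‖gibbsSum G (character B) t‖ = 0 := by nlinarith
    rw [h4]; exact norm_nonneg _

lemma gibbsSum_one_ne_zero {t : ℂ} {θ : ℝ} (h0 : 0 ≤ θ) (ht : ‖t‖ = Real.tan θ) {d : ℕ}
    (hG : ∀ i, G.degree i ≤ d) (hd : d * θ < Real.pi / 4) (ht1 : ‖t‖ < 1) :
    gibbsSum G (fun _ => 1) t ≠ 0 := by
  intro hZ
  have hall : ∀ A, ‖∑ σ, character A σ * weight G t σ‖ ≤ 0 := fun A => by
    have := norm_gibbsSum_character_le_partition G h0 ht hG hd A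
    rwa [hZ, norm_zero] at this
  have hprod : ∀ S : Finset V, ∃ c, WienerBound c fun σ => ∏ i ∈ S, (1 + cspin σ i) := by
    intro S
    induction S using Finset.induction_on with
    | empty => exact ⟨1, by simpa using wienerBound_one (V := V)⟩
    | insert a S ha ih =>
      obtain ⟨c, hc⟩ := ih
      have h1 : WienerBound (1 + 1) fun σ : V → ℤˣ => 1 + cspin σ a :=
        wienerBound_one.add (wienerBound_cspin a)
      exact ⟨_, by simpa [prod_insert ha] using h1.mul hc⟩
  obtain ⟨c, hc⟩ := hprod univ
  have h1 := hc (weight G t) 0 hall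
  rw [sum_eq_single_of_mem (fun _ => 1) (mem_univ _)] at h1
  · have h2 : ∏ i : V, (1 + cspin (fun _ => 1) i) ≠ 0 :=
      prod_ne_zero_iff.2 fun i _ => by simp [cspin]
    have h3 : weight G t (fun _ => 1) ≠ 0 := by
      refine prod_ne_zero_iff.2 fun e _ => ?_
      induction e with
      | _ i j =>
        intro h
        have : t = -1 := by simp [cspin] at h; linear_combination h
        rw [this] at ht1; simp at ht1
    rw [mul_zero, norm_le_zero_iff] at h1
    exact mul_ne_zero h2 h3 h1
  · intro σ _ hσ
    obtain ⟨i, hi⟩ := Function.ne_iff.1 hσ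
    have : cspin σ i = -1 := by
      rcases Int.units_eq_one_or (σ i) with h | h
      · exact absurd h hi
      · simp [cspin, h]
    exact mul_eq_zero_of_left (prod_eq_zero (mem_univ i) (by rw [this]; ring)) _

/-- Correlation identity at the site `i`, for observables that are odd in the spin at `i`. -/
lemma gibbsSum_prod_star_eq_zero (t : ℂ) (i : V) (f : (V → ℤˣ) → ℂ)
    (hf : ∀ σ, f (flipAt i σ) = -f σ) :
    gibbsSum G (fun σ => f σ * ∏ b ∈ G.neighborFinset i, (1 - t * (cspin σ i * cspin σ b))) t
      = 0 := by
  have key : ∀ σ, f σ * (∏ b ∈ G.neighborFinset i, (1 - t * (cspin σ i * cspin σ b))) *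
      weight G t σ = f σ * ((1 - t ^ 2) ^ #(G.neighborFinset i) * restWeight G i t σ) := by
    intro σ
    have : (∏ b ∈ G.neighborFinset i, (1 - t * (cspin σ i * cspin σ b))) *
        ∏ b ∈ G.neighborFinset i, (1 + t * (cspin σ i * cspin σ b)) =
        (1 - t ^ 2) ^ #(G.neighborFinset i) := by
      rw [← prod_mul_distrib, prod_congr rfl, prod_const]
      intro b _
      linear_combination (-t ^ 2) * (cspin σ b * cspin σ b * cspin_mul_self σ i) -
        t ^ 2 * cspin_mul_self σ b
    rw [weight_eq G i, ← this]
    ring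
  rw [gibbsSum]
  simp only [key]
  refine sum_eq_zero_of_flipAt i _ fun σ => ?_
  rw [hf, restWeight_flipAt]
  ring

end Graph

/-! ### Families of bounded analytic functions on a disk -/

section Analytic

open Metric

/-- The Taylor coefficients of `f` at the origin. -/
def taylorCoeff (f : ℂ → ℂ) (k : ℕ) : ℂ := iteratedDeriv k f 0 / k.factorial

variable {R C : ℝ} {f : ℂ → ℂ}

lemma hasSum_taylorCoeff (hf : DifferentiableOn ℂ f (ball 0 R)) {z : ℂ} (hz : z ∈ ball (0 : ℂ) R) :
    HasSum (fun k => taylorCoeff f k * z ^ k) (f z) := by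
  have e : (fun k => taylorCoeff f k * z ^ k) =
      fun k => ((k.factorial : ℂ))⁻¹ • (z - 0) ^ k • iteratedDeriv k f 0 := by
    funext k
    simp only [taylorCoeff, smul_eq_mul, sub_zero]
    ring
  rw [e]
  exact Complex.hasSum_taylorSeries_on_ball hf hz

lemma norm_taylorCoeff_le {ρ : ℝ} (hρ : 0 < ρ) (hρR : ρ < R)
    (hf : DifferentiableOn ℂ f (ball 0 R)) (hC : ∀ z : ℂ, ‖z‖ = ρ → ‖f z‖ ≤ C) (k : ℕ) :
    ‖taylorCoeff f k‖ ≤ C / ρ ^ k := by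
  have h := Complex.norm_iteratedDeriv_le_of_forall_mem_sphere_norm_le (c := (0 : ℂ)) (f := f)
    (C := C) k hρ ((hf.mono (closedBall_subset_ball hρR)).diffContOnCl_ball subset_rfl)
    fun z hz => hC z (by simpa using hz)
  have hk : (0 : ℝ) < k.factorial := by exact_mod_cast k.factorial_pos
  rw [taylorCoeff, norm_div, Complex.norm_natCast, div_le_iff₀ hk]
  exact h.trans_eq (by ring)

lemma taylorCoeff_eq_zero_of_isBigO (hR : 0 < R) (hf : DifferentiableOn ℂ f (ball 0 R)) {n k : ℕ}
    (hk : k < n) (hO : f =O[𝓝 0] fun z : ℂ => z ^ n) : taylorCoeff f k = 0 := by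
  obtain ⟨c, hc⟩ := hO.bound
  obtain ⟨ε, hε, hb⟩ := Metric.eventually_nhds_iff.1 hc
  have hlim : Tendsto (fun ρ : ℝ => c * ρ ^ (n - k)) (𝓝[>] 0) (𝓝 0) := by
    have : Tendsto (fun ρ : ℝ => c * ρ ^ (n - k)) (𝓝 0) (𝓝 (c * 0 ^ (n - k))) :=
      (Continuous.tendsto (by fun_prop) 0)
    rw [zero_pow (by omega), mul_zero] at this
    exact this.mono_left nhdsWithin_le_nhds
  have hle : ∀ᶠ ρ : ℝ in 𝓝[>] 0, ‖taylorCoeff f k‖ ≤ c * ρ ^ (n - k) := by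
    filter_upwards [Ioo_mem_nhdsGT (lt_min hε hR)] with ρ hρ
    have h1 : ρ < ε := hρ.2.trans_le (min_le_left _ _)
    have h2 : ρ < R := hρ.2.trans_le (min_le_right _ _)
    refine (norm_taylorCoeff_le hρ.1 h2 hf (C := c * ρ ^ n) ?_ k).trans_eq ?_
    · intro z hz
      have := hb (y := z) (by simpa [hz] using h1)
      simpa [hz] using this
    · have : ρ ^ n = ρ ^ (n - k) * ρ ^ k := by rw [← pow_add]; congr 1; omega
      rw [this]
      have := hρ.1.ne'
      field_simp
  exact norm_le_zero_iff.1 (ge_of_tendsto hlim hle)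

lemma taylorCoeff_sub (hR : 0 < R) {g : ℂ → ℂ} (hf : DifferentiableOn ℂ f (ball 0 R))
    (hg : DifferentiableOn ℂ g (ball 0 R)) (k : ℕ) :
    taylorCoeff (fun z => f z - g z) k = taylorCoeff f k - taylorCoeff g k := by
  have h0 : (0 : ℂ) ∈ ball (0 : ℂ) R := by simpa using hR
  have h1 := (hf.analyticAt (isOpen_ball.mem_nhds h0)).contDiffAt (n := k)
  have h2 := (hg.analyticAt (isOpen_ball.mem_nhds h0)).contDiffAt (n := k)
  have h3 : iteratedDeriv k (f - g) 0 = _ := iteratedDeriv_sub h1 h2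
  rw [taylorCoeff, taylorCoeff, taylorCoeff, ← sub_div]
  exact congrArg (· / _) h3

lemma im_iteratedDeriv_eq_zero (hf : DifferentiableOn ℂ f (ball 0 R))
    (him : ∀ x : ℝ, |x| < R → (f x).im = 0) (k : ℕ) :
    DifferentiableOn ℂ (iteratedDeriv k f) (ball 0 R) ∧
      ∀ x : ℝ, |x| < R → (iteratedDeriv k f x).im = 0 := by
  induction k with
  | zero => simpa using ⟨hf, him⟩
  | succ k ih =>
    rw [iteratedDeriv_succ]
    refine ⟨ih.1.deriv isOpen_ball, fun x hx => ?_⟩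
    have hxb : (x : ℂ) ∈ ball (0 : ℂ) R := by simpa using hx
    have h1 := ((ih.1.differentiableAt (isOpen_ball.mem_nhds hxb)).hasDerivAt).comp_ofReal
    have h2 : HasDerivAt (fun y : ℝ => (iteratedDeriv k f y).im) (deriv (iteratedDeriv k f) x).im x := by
      exact Complex.imCLM.hasFDerivAt.comp_hasDerivAt x h1
    have h3 : (fun y : ℝ => (iteratedDeriv k f y).im) =ᶠ[𝓝 x] fun _ => 0 := by
      filter_upwards [(isOpen_lt continuous_abs continuous_const).mem_nhds hx] with y hy
      exact ih.2 y hy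
    exact (h2.congr_of_eventuallyEq h3.symm).unique (hasDerivAt_const x 0)

lemma ofReal_re_taylorCoeff (hR : 0 < R) (hf : DifferentiableOn ℂ f (ball 0 R))
    (him : ∀ x : ℝ, |x| < R → (f x).im = 0) (k : ℕ) :
    ((taylorCoeff f k).re : ℂ) = taylorCoeff f k := by
  apply Complex.ext
  · simp
  · have := (im_iteratedDeriv_eq_zero hf him k).2 0 (by simpa using hR)
    simp only [Complex.ofReal_zero] at this
    rw [taylorCoeff, show ((k.factorial : ℂ)) = ((k.factorial : ℝ) : ℂ) by simp,
      Complex.div_ofReal_im, this]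
    simp

lemma hasFPowerSeriesOnBall_of_norm_le (hR : 0 < R) {c : ℕ → ℂ}
    (hc : ∀ ρ, 0 < ρ → ρ < R → ∀ k, ‖c k‖ ≤ C / ρ ^ k)
    (hs : ∀ z ∈ ball (0 : ℂ) R, HasSum (fun k => c k * z ^ k) (f z)) :
    HasFPowerSeriesOnBall f (FormalMultilinearSeries.ofScalars ℂ c) 0 (ENNReal.ofReal R) where
  r_le := by
    refine ENNReal.le_of_forall_nnreal_lt fun r hr => ?_
    rcases eq_or_ne r 0 with rfl | h0
    · simp
    have h0' : 0 < (r : ℝ) := by positivity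
    refine FormalMultilinearSeries.le_radius_of_bound _ C fun k => ?_
    rw [FormalMultilinearSeries.ofScalars_norm]
    have h1 : (r : ℝ) < R := by
      rw [← ENNReal.ofReal_coe_nnreal] at hr
      exact (ENNReal.ofReal_lt_ofReal_iff hR).1 hr
    exact (le_div_iff₀ (by positivity)).1 (hc r h0' h1 k)
  r_pos := by simpa using hR
  hasSum := by
    intro y hy
    rw [Metric.eball_ofReal] at hy
    simpa [FormalMultilinearSeries.ofScalars_apply_eq, mul_comm] using hs y hy

/-- The limit of a bounded family of analytic functions whose Taylor coefficients stabilize. -/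
theorem exists_limit_of_isBigO_sub (hR : 0 < R) (f : ℕ+ → ℂ → ℂ)
    (hd : ∀ n, DifferentiableOn ℂ (f n) (ball 0 R)) (hC : ∀ n, ∀ z ∈ ball (0 : ℂ) R, ‖f n z‖ ≤ C)
    (him : ∀ n, ∀ x : ℝ, |x| < R → (f n x).im = 0)
    (hO : ∀ n m, n ≤ m → (fun z => f n z - f m z) =O[𝓝 0] fun z : ℂ => z ^ (n : ℕ)) :
    ∃ (F : WithTop ℕ+ → ℂ → ℂ) (c : WithTop ℕ+ → ℕ → ℝ), (∀ n : ℕ+, F n = f n) ∧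
      (∀ z ∈ ball (0 : ℂ) R, Tendsto (fun n => f n z) atTop (𝓝 (F ⊤ z))) ∧
      (∀ N, HasFPowerSeriesOnBall (F N)
        (FormalMultilinearSeries.ofScalars ℂ fun k => (c N k : ℂ)) 0 (ENNReal.ofReal R)) ∧
      (∀ ρ < R, TendstoUniformlyOn
        (fun (m : ℕ) (p : WithTop ℕ+ × ℂ) => ∑ k ∈ Finset.range m, (c p.1 k : ℂ) * p.2 ^ k)
        (fun p => F p.1 p.2) atTop (Set.univ ×ˢ closedBall (0 : ℂ) ρ)) ∧
      (∀ (n : ℕ+) (k : ℕ), k < (n : ℕ) → c n k = c ⊤ k) := by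
  have hcoef : ∀ n m : ℕ+, n ≤ m → ∀ k < (n : ℕ), taylorCoeff (f n) k = taylorCoeff (f m) k := by
    intro n m hnm k hk
    have := taylorCoeff_eq_zero_of_isBigO hR ((hd n).sub (hd m)) hk (hO n m hnm)
    rw [← sub_eq_zero, ← taylorCoeff_sub hR (hd n) (hd m)]
    exact this
  let c : WithTop ℕ+ → ℕ → ℝ := WithTop.recTopCoe
    (fun k => (taylorCoeff (f k.succPNat) k).re) (fun n k => (taylorCoeff (f n) k).re)
  have hcn : ∀ (n : ℕ+) k, (c n k : ℂ) = taylorCoeff (f n) k := fun n k =>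
    ofReal_re_taylorCoeff hR (hd n) (him n) k
  have hct : ∀ k, c ⊤ k = c (k.succPNat : ℕ+) k := fun k => rfl
  have hagree : ∀ (n : ℕ+) (k : ℕ), k < (n : ℕ) → c n k = c ⊤ k := by
    intro n k hk
    rw [hct]
    change (taylorCoeff (f n) k).re = (taylorCoeff (f k.succPNat) k).re
    congr 1
    refine (hcoef _ _ ?_ k ?_).symm
    · rw [← PNat.coe_le_coe]; simpa using hk
    · simp
  have hbound : ∀ N ρ, 0 < ρ → ρ < R → ∀ k, ‖(c N k : ℂ)‖ ≤ C / ρ ^ k := by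
    intro N ρ h0 h1 k
    have key : ∀ n : ℕ+, ‖(c n k : ℂ)‖ ≤ C / ρ ^ k := fun n => by
      rw [hcn]
      exact norm_taylorCoeff_le h0 h1 (hd n) (fun z hz => hC n z (by simpa [hz] using h1)) k
    induction N using WithTop.recTopCoe with
    | top => rw [hct]; exact key _
    | coe n => exact key n
  have hterm : ∀ N ρ ρ' (z : ℂ), 0 < ρ' → ρ' < R → ‖z‖ ≤ ρ → ∀ k,
      ‖(c N k : ℂ) * z ^ k‖ ≤ C * (ρ / ρ') ^ k := by
    intro N ρ ρ' z h0 h1 hz k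
    rw [norm_mul, norm_pow, div_pow]
    calc _ ≤ C / ρ' ^ k * ρ ^ k := mul_le_mul (hbound N ρ' h0 h1 k)
          (pow_le_pow_left₀ (norm_nonneg _) hz k) (by positivity)
          ((norm_nonneg _).trans (hbound N ρ' h0 h1 k))
      _ = _ := by ring
  have hsumm : ∀ ρ ρ' : ℝ, 0 ≤ ρ → ρ < ρ' → Summable fun k : ℕ => C * (ρ / ρ') ^ k := by
    intro ρ ρ' h0 h1
    exact (summable_geometric_of_lt_one (div_nonneg h0 (h0.trans h1.le))
      ((div_lt_one (h0.trans_lt h1)).2 h1)).mul_left C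
  let F : WithTop ℕ+ → ℂ → ℂ := WithTop.recTopCoe (fun z => ∑' k, (c ⊤ k : ℂ) * z ^ k) f
  have hsum : ∀ N, ∀ z ∈ ball (0 : ℂ) R, HasSum (fun k => (c N k : ℂ) * z ^ k) (F N z) := by
    intro N z hz
    induction N using WithTop.recTopCoe with
    | top =>
      have hz' : ‖z‖ < R := by simpa using hz
      obtain ⟨ρ', h1, h2⟩ := exists_between hz'
      exact (Summable.of_norm_bounded (hsumm ‖z‖ ρ' (norm_nonneg _) h1)
        (hterm ⊤ ‖z‖ ρ' z ((norm_nonneg _).trans_lt h1) h2 le_rfl)).hasSum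
    | coe n =>
      simp only [hcn]
      exact hasSum_taylorCoeff (hd n) hz
  refine ⟨F, c, fun n => rfl, fun z hz => ?_,
    fun N => hasFPowerSeriesOnBall_of_norm_le hR (hbound N) (hsum N), fun ρ hρ => ?_, hagree⟩
  · have hz' : ‖z‖ < R := by simpa using hz
    obtain ⟨ρ', h1, h2⟩ := exists_between hz'
    have e : ∀ n : ℕ+, f n z = ∑' k, (c n k : ℂ) * z ^ k := fun n => (hsum n z hz).tsum_eq.symm
    rw [← (hsum ⊤ z hz).tsum_eq]
    simp only [e]
    refine tendsto_tsum_of_dominated_convergence (hsumm ‖z‖ ρ' (norm_nonneg _) h1) ?_ ?_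
    · intro k
      refine tendsto_const_nhds.congr' ?_
      filter_upwards [eventually_ge_atTop k.succPNat] with n hn
      rw [hagree n k]
      have : (k.succPNat : ℕ) ≤ n := hn
      simpa using this
    · exact Eventually.of_forall fun n k =>
        hterm n ‖z‖ ρ' z ((norm_nonneg _).trans_lt h1) h2 le_rfl k
  · rcases lt_or_ge ρ 0 with h | h
    · rw [closedBall_eq_empty.2 h, Set.prod_empty]
      exact tendstoUniformlyOn_empty
    obtain ⟨ρ', h1, h2⟩ := exists_between hρ
    have := tendstoUniformlyOn_tsum_nat (hsumm ρ ρ' h h1)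
      (f := fun k (p : WithTop ℕ+ × ℂ) => (c p.1 k : ℂ) * p.2 ^ k)
      (s := Set.univ ×ˢ closedBall (0 : ℂ) ρ)
      fun k p hp => hterm p.1 ρ ρ' p.2 (h.trans_lt h1) h2 (by simpa using hp.2) k
    refine this.congr_right fun p hp => ?_
    have hp2 : ‖p.2‖ ≤ ρ := by simpa using hp.2
    exact (hsum p.1 p.2 (by simpa using hp2.trans_lt hρ)).tsum_eq

end Analytic

/-! ### The radii -/

section Radius

lemma sqrt_two_lt_sqrt_three : √(2 : ℝ) < √3 := Real.sqrt_lt_sqrt (by norm_num) (by norm_num)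

lemma one_lt_sqrt_two : 1 < √(2 : ℝ) := by
  rw [Real.lt_sqrt] <;> norm_num

lemma tRadius_pos : 0 < tRadius :=
  mul_pos (sub_pos.2 sqrt_two_lt_sqrt_three) (sub_pos.2 one_lt_sqrt_two)

lemma tRadius_sq :
    tRadius ^ 2 = 15 - 10 * √2 - 6 * (√2 * √3) + 8 * √3 := by
  have ha : √(2 : ℝ) ^ 2 = 2 := Real.sq_sqrt (by norm_num)
  have hb : √(3 : ℝ) ^ 2 = 3 := Real.sq_sqrt (by norm_num)
  have h1 : (√3 - √2 : ℝ) ^ 2 = 5 - 2 * (√2 * √3) := by linear_combination ha + hb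
  have h2 : (√2 - 1 : ℝ) ^ 2 = 3 - 2 * √2 := by linear_combination ha
  rw [tRadius, mul_pow, h1, h2]
  linear_combination 4 * √3 * ha

lemma tRadius_lt : tRadius < 1 / 5 := by
  have ha : √(2 : ℝ) ^ 2 = 2 := Real.sq_sqrt (by norm_num)
  have hb : √(3 : ℝ) ^ 2 = 3 := Real.sq_sqrt (by norm_num)
  have h1 : √(2 : ℝ) < 1.42 := by rw [Real.sqrt_lt' (by norm_num)]; norm_num
  have h2 : (1.41 : ℝ) < √(2 : ℝ) := by rw [Real.lt_sqrt (by norm_num)]; norm_num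
  have h3 : √(3 : ℝ) < 1.74 := by rw [Real.sqrt_lt' (by norm_num)]; norm_num
  rw [tRadius]
  nlinarith [sqrt_two_lt_sqrt_three, one_lt_sqrt_two]

lemma kRadius_eq : kRadius = Real.pi / 24 := by
  have ha : √(2 : ℝ) ^ 2 = 2 := Real.sq_sqrt (by norm_num)
  have hb : √(3 : ℝ) ^ 2 = 3 := Real.sq_sqrt (by norm_num)
  have h0 := tRadius_pos
  have h1 := tRadius_lt
  have a1 := one_lt_sqrt_two
  have a2 : √(2 : ℝ) < 2 := by rw [Real.sqrt_lt' (by norm_num)]; norm_num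
  have e2 := Real.two_mul_arctan (x := tRadius) (by linarith) (by linarith)
  have hq : 0 < 1 - tRadius ^ 2 := by nlinarith
  have hq3 : 0 < 1 - 3 * tRadius ^ 2 := by nlinarith
  have hlt : tRadius * (2 * tRadius / (1 - tRadius ^ 2)) < 1 := by
    rw [← mul_div_assoc, div_lt_one hq]; nlinarith
  have e3 := Real.arctan_add hlt
  have hcubic : tRadius * (3 - tRadius ^ 2) = (√2 - 1) * (1 - 3 * tRadius ^ 2) := by
    rw [tRadius_sq, tRadius]
    ring_nf
    have a3 : √(2 : ℝ) ^ 3 = 2 * √2 := by linear_combination √2 * ha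
    simp only [a3, ha, hb]
    ring
  have e4 : (tRadius + 2 * tRadius / (1 - tRadius ^ 2)) /
      (1 - tRadius * (2 * tRadius / (1 - tRadius ^ 2))) = √2 - 1 := by
    have : 1 - tRadius * (2 * tRadius / (1 - tRadius ^ 2)) =
        (1 - 3 * tRadius ^ 2) / (1 - tRadius ^ 2) := by field_simp; ring
    rw [this, show tRadius + 2 * tRadius / (1 - tRadius ^ 2) =
      tRadius * (3 - tRadius ^ 2) / (1 - tRadius ^ 2) by field_simp; ring, hcubic,
      div_div_div_cancel_right₀ hq.ne', mul_div_cancel_right₀ _ hq3.ne']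
  have e5 := Real.two_mul_arctan (x := √2 - 1) (by linarith) (by linarith)
  have e6 : 2 * (√2 - 1) / (1 - (√2 - 1) ^ 2) = (1 : ℝ) := by
    have : (1 - (√2 - 1) ^ 2 : ℝ) = 2 * (√2 - 1) := by linear_combination -ha
    rw [this, div_self]
    have := sub_pos.2 a1
    positivity
  rw [e4] at e3
  rw [e6, Real.arctan_one] at e5
  rw [kRadius]
  linarith

lemma kRadius_pos : 0 < kRadius := by
  rw [kRadius_eq]; positivity

lemma six_mul_arctan_lt {t : ℂ} (ht : ‖t‖ < tRadius) :
    ((6 : ℕ) : ℝ) * Real.arctan ‖t‖ < Real.pi / 4 := by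
  have := Real.arctan_strictMono ht
  have h2 := kRadius_eq
  rw [kRadius] at h2
  push_cast
  linarith

end Radius

/-! ### The periodic cubic lattice -/

section Torus

open Finset

/-- The six signed coordinate directions. -/
abbrev Dir : Type := Fin 3 × Bool

/-- The signed coordinate unit vectors. -/
def dirVec (R : Type*) [Ring R] (p : Dir) : Fin 3 → R := Pi.single p.1 (cond p.2 1 (-1))

lemma dirVec_apply (R : Type*) [Ring R] (p : Dir) (k : Fin 3) :
    dirVec R p k = if k = p.1 then cond p.2 1 (-1) else 0 := by
  simp [dirVec, Pi.single_apply]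

lemma cond_ne_zero {R : Type*} [Ring R] [Nontrivial R] (b : Bool) : cond b (1 : R) (-1) ≠ 0 := by
  cases b <;> simp

lemma dirVec_ne_zero {R : Type*} [Ring R] [Nontrivial R] (p : Dir) : dirVec R p ≠ 0 := fun h => by
  have := congrFun h p.1
  simp only [dirVec_apply, if_true, Pi.zero_apply] at this
  exact cond_ne_zero _ this

lemma dirVec_injective {R : Type*} [Ring R] [Nontrivial R] (h2 : (1 : R) ≠ -1) :
    Function.Injective (dirVec R) := by
  rintro ⟨k, a⟩ ⟨l, b⟩ h
  have h1 := congrFun h k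
  simp only [dirVec_apply, if_true] at h1
  have hkl : k = l := by
    by_contra hne
    rw [if_neg hne] at h1
    exact cond_ne_zero _ h1
  subst hkl
  rw [if_pos rfl] at h1
  cases a <;> cases b <;> simp_all [eq_comm]

lemma natAbs_dirVec_le (p : Dir) (k : Fin 3) : |dirVec ℤ p k| ≤ 1 := by
  rw [dirVec_apply]
  split_ifs
  · cases p.2 <;> simp
  · simp

variable (n : ℕ) [NeZero n]

lemma neighborFinset_subset (x : Site n) :
    (torusGraph n).neighborFinset x ⊆ univ.image fun p : Dir => x + dirVec (ZMod n) p := by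
  intro y hy
  rw [SimpleGraph.mem_neighborFinset] at hy
  obtain ⟨-, k, h | h⟩ := hy
  · refine mem_image.2 ⟨(k, false), mem_univ _, ?_⟩
    have : dirVec (ZMod n) (k, false) = -Pi.single k 1 := by simp [dirVec, Pi.single_neg]
    rw [this, ← h]; abel
  · refine mem_image.2 ⟨(k, true), mem_univ _, ?_⟩
    have : dirVec (ZMod n) (k, true) = Pi.single k 1 := by simp [dirVec]
    rw [this, ← neg_neg (Pi.single k 1 : Site n), ← h]; abel

lemma degree_torusGraph_le (x : Site n) : (torusGraph n).degree x ≤ 6 := by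
  rw [← SimpleGraph.card_neighborFinset_eq_degree]
  exact (card_le_card (neighborFinset_subset n x)).trans (card_image_le.trans (by simp))

variable {n}

omit [NeZero n] in
lemma one_ne_neg_one_zmod (hn : 3 ≤ n) : (1 : ZMod n) ≠ -1 := by
  intro h
  have h2 : ((2 : ℕ) : ZMod n) = 0 := by
    push_cast
    linear_combination h
  rw [ZMod.natCast_eq_zero_iff] at h2
  have := Nat.le_of_dvd (by norm_num) h2
  omega

omit [NeZero n] in
lemma add_dirVec_injective (hn : 3 ≤ n) (x : Site n) :
    Function.Injective fun p : Dir => x + dirVec (ZMod n) p :=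
  have : Fact (1 < n) := ⟨by omega⟩
  (add_right_injective x).comp (dirVec_injective (one_ne_neg_one_zmod hn))

lemma neighborFinset_eq (hn : 3 ≤ n) (x : Site n) :
    (torusGraph n).neighborFinset x = univ.image fun p : Dir => x + dirVec (ZMod n) p := by
  have : Fact (1 < n) := ⟨by omega⟩
  refine (neighborFinset_subset n x).antisymm fun y hy => ?_
  obtain ⟨p, -, rfl⟩ := mem_image.1 hy
  rw [SimpleGraph.mem_neighborFinset]
  refine ⟨fun h => dirVec_ne_zero p (by simpa using h.symm), p.1, ?_⟩
  obtain ⟨k, b⟩ := p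
  cases b
  · left; simp [dirVec, Pi.single_neg]
  · right; simp [dirVec]

/-- The partition function of the torus in the high-temperature variable, up to an elementary
factor. -/
def torusSum (n : ℕ) [NeZero n] : ((Site n → ℤˣ) → ℂ) → ℂ → ℂ := gibbsSum (torusGraph n)

lemma torusSum_one_ne_zero {t : ℂ} (ht : ‖t‖ < tRadius) : torusSum n (fun _ => 1) t ≠ 0 :=
  gibbsSum_one_ne_zero _ (Real.arctan_nonneg.2 (norm_nonneg t)) (Real.tan_arctan _).symm
    (degree_torusGraph_le n) (six_mul_arctan_lt ht) (ht.trans (tRadius_lt.trans (by norm_num)))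

lemma norm_torusSum_character_le {t : ℂ} (ht : ‖t‖ < tRadius) (A : Finset (Site n)) :
    ‖torusSum n (character A) t‖ ≤ ‖torusSum n (fun _ => 1) t‖ :=
  norm_gibbsSum_character_le_partition _ (Real.arctan_nonneg.2 (norm_nonneg t))
    (Real.tan_arctan _).symm (degree_torusGraph_le n) (six_mul_arctan_lt ht) A

lemma torusSum_character_zero {A : Finset (Site n)} (hA : A.Nonempty) :
    torusSum n (character A) 0 = 0 := by
  have h := norm_gibbsSum_character_le (torusGraph n) (t := 0) (θ := 0) (d := 6) le_rfl
    (by simp) (degree_torusGraph_le n) (by simpa using Real.pi_pos) hA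
    (M := ‖torusSum n (fun _ => 1) 0‖)
    fun B => norm_torusSum_character_le (by simpa using tRadius_pos) B
  simpa [torusSum] using h

/-! ### Local observables on different tori -/

/-- The site of the torus that corresponds to `x` if the origin is placed at `c`. -/
def toSite (n : ℕ) (c : Site n) (x : Fin 3 → ℤ) : Site n := fun k => (x k : ZMod n) + c k

omit [NeZero n] in
lemma toSite_add_dirVec (c : Site n) (x : Fin 3 → ℤ) (p : Dir) :
    toSite n c (x + dirVec ℤ p) = toSite n c x + dirVec (ZMod n) p := by
  ext k
  simp only [toSite, Pi.add_apply, dirVec_apply]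
  split_ifs
  · cases p.2 <;> simp <;> ring
  · simp

/-- The product of the spins at the images of the points of `A`. -/
def localObs (n : ℕ) (c : Site n) (A : Finset (Fin 3 → ℤ)) (σ : Site n → ℤˣ) : ℂ :=
  ∏ x ∈ A, cspin σ (toSite n c x)

omit [NeZero n] in
lemma localObs_symmDiff (c : Site n) (A B : Finset (Fin 3 → ℤ)) (σ : Site n → ℤˣ) :
    localObs n c (symmDiff A B) σ = localObs n c A σ * localObs n c B σ :=
  prod_symmDiff_of_mul_self A B _ fun _ => cspin_mul_self σ _

/-- The points at which the product of the bonds from `i` in the directions `B` has a spin. -/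
def starSupport (i : Fin 3 → ℤ) (B : Finset Dir) : Finset (Fin 3 → ℤ) :=
  if Even #B then B.image fun p => i + dirVec ℤ p
  else insert i (B.image fun p => i + dirVec ℤ p)

lemma mem_starSupport {i : Fin 3 → ℤ} {B : Finset Dir} {x : Fin 3 → ℤ}
    (hx : x ∈ starSupport i B) : x = i ∨ ∃ p ∈ B, x = i + dirVec ℤ p := by
  have : x = i ∨ x ∈ B.image fun p => i + dirVec ℤ p := by
    rw [starSupport] at hx
    split_ifs at hx
    · exact Or.inr hx
    · exact mem_insert.1 hx
  refine this.imp_right fun h => ?_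
  obtain ⟨p, hp, rfl⟩ := mem_image.1 h
  exact ⟨p, hp, rfl⟩

omit [NeZero n] in
lemma localObs_starSupport (c : Site n) (i : Fin 3 → ℤ) (B : Finset Dir) (σ : Site n → ℤˣ) :
    localObs n c (starSupport i B) σ =
      ∏ p ∈ B, (cspin σ (toSite n c i) * cspin σ (toSite n c i + dirVec (ZMod n) p)) := by
  have hinj : Function.Injective fun p : Dir => i + dirVec ℤ p :=
    (add_right_injective i).comp (dirVec_injective (by norm_num))
  have himg : ∏ x ∈ B.image (fun p => i + dirVec ℤ p), cspin σ (toSite n c x) =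
      ∏ p ∈ B, cspin σ (toSite n c i + dirVec (ZMod n) p) := by
    rw [prod_image fun p _ q _ h => hinj h]
    simp only [toSite_add_dirVec]
  rw [prod_mul_distrib, prod_const, localObs, starSupport]
  split_ifs with h
  · obtain ⟨m, hm⟩ := h
    rw [himg, hm, ← two_mul, pow_mul, cspin_sq, one_pow, one_mul]
  · rw [prod_insert, himg]
    · obtain ⟨m, hm⟩ := Nat.not_even_iff_odd.1 h
      rw [hm, pow_succ, pow_mul, cspin_sq, one_pow, one_mul]
    · intro hi
      obtain ⟨p, -, hp⟩ := mem_image.1 hi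
      exact dirVec_ne_zero p (by simpa using hp)

/-- The correlation identity for local observables. -/
lemma sum_starSupport_eq_zero (hn : 3 ≤ n) (c : Site n) {A : Finset (Fin 3 → ℤ)}
    (hA : Set.InjOn (toSite n c) A) {i : Fin 3 → ℤ} (hi : i ∈ A) (t : ℂ) :
    ∑ B : Finset Dir, (-t) ^ #B * torusSum n (localObs n c (symmDiff A (starSupport i B))) t
      = 0 := by
  have hodd : ∀ σ, localObs n c A (flipAt (toSite n c i) σ) = -localObs n c A σ := by
    intro σ
    rw [localObs, localObs, ← mul_prod_erase _ _ hi, ← mul_prod_erase A _ hi, cspin_flipAt_self,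
      neg_mul]
    congr 2
    refine prod_congr rfl fun x hx => cspin_flipAt_of_ne (fun h => ?_) σ
    exact ne_of_mem_erase hx (hA (mem_of_mem_erase hx) hi h)
  have h := gibbsSum_prod_star_eq_zero (torusGraph n) t (toSite n c i) (localObs n c A) hodd
  rw [← h]
  simp only [torusSum, gibbsSum, mul_sum]
  rw [sum_comm]
  refine sum_congr rfl fun σ _ => ?_
  rw [neighborFinset_eq hn, prod_image fun p _ q _ h => add_dirVec_injective hn _ h]
  simp only [sub_eq_add_neg]
  rw [prod_one_add, powerset_univ, mul_sum, sum_mul]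
  refine sum_congr rfl fun B _ => ?_
  rw [localObs_symmDiff, localObs_starSupport]
  simp only [← neg_mul]
  rw [prod_mul_distrib (f := fun _ => -t), prod_const]
  ring

/-- The expectation of a local observable. -/
def localMean (n : ℕ) [NeZero n] (c : Site n) (A : Finset (Fin 3 → ℤ)) (t : ℂ) : ℂ :=
  torusSum n (localObs n c A) t / torusSum n (fun _ => 1) t

lemma localMean_eq (hn : 3 ≤ n) (c : Site n) {A : Finset (Fin 3 → ℤ)}
    (hA : Set.InjOn (toSite n c) A) {i : Fin 3 → ℤ} (hi : i ∈ A) (t : ℂ) :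
    localMean n c A t = -∑ B ∈ univ.erase (∅ : Finset Dir),
      (-t) ^ #B * localMean n c (symmDiff A (starSupport i B)) t := by
  have h := sum_starSupport_eq_zero hn c hA hi t
  rw [← add_sum_erase _ _ (mem_univ ∅)] at h
  have h0 : symmDiff A (starSupport i ∅) = A := by
    simp [starSupport]
  rw [h0, card_empty, pow_zero, one_mul] at h
  simp only [localMean, ← mul_div_assoc, ← sum_div]
  rw [← neg_div]
  congr 1
  linear_combination h

omit [NeZero n] in
lemma localObs_eq_character (c : Site n) (A : Finset (Fin 3 → ℤ)) :
    ∃ B : Finset (Site n), localObs n c A = character B := by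
  induction A using Finset.induction_on with
  | empty => exact ⟨∅, by ext; simp [localObs]⟩
  | insert a A ha ih =>
    obtain ⟨B, hB⟩ := ih
    refine ⟨symmDiff {toSite n c a} B, ?_⟩
    ext σ
    rw [character_symmDiff, ← hB, localObs, prod_insert ha, ← localObs]
    simp [character]

lemma norm_localMean_le {t : ℂ} (ht : ‖t‖ < tRadius) (c : Site n) (A : Finset (Fin 3 → ℤ)) :
    ‖localMean n c A t‖ ≤ 1 := by
  obtain ⟨B, hB⟩ := localObs_eq_character c A
  rw [localMean, hB, norm_div]
  exact div_le_one_of_le₀ (norm_torusSum_character_le ht B) (norm_nonneg _)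

lemma eventually_norm_lt_tRadius : ∀ᶠ t : ℂ in 𝓝 0, ‖t‖ < tRadius := by
  have := Metric.ball_mem_nhds (0 : ℂ) tRadius_pos
  filter_upwards [this] with t ht
  simpa using ht

lemma localMean_empty {t : ℂ} (ht : ‖t‖ < tRadius) (c : Site n) : localMean n c ∅ t = 1 := by
  have : localObs n c ∅ = fun _ => 1 := by ext; simp [localObs]
  rw [localMean, this, div_self (torusSum_one_ne_zero ht)]

omit [NeZero n] in
lemma injOn_toSite (c : Site n) {A : Finset (Fin 3 → ℤ)}
    (hA : ∀ x ∈ A, ∀ y ∈ A, ∀ k, |x k - y k| < n) : Set.InjOn (toSite n c) A := by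
  intro x hx y hy h
  ext k
  have h1 := congrFun h k
  simp only [toSite, add_left_inj] at h1
  rw [ZMod.intCast_eq_intCast_iff_dvd_sub] at h1
  have h2 := Int.eq_zero_of_abs_lt_dvd h1 (hA y hy x hx k)
  omega

/-- Expectations of local observables do not depend on the size of the torus up to the order at
which they feel the periodicity. -/
theorem localMean_sub_isBigO {n₁ n₂ m : ℕ} [NeZero n₁] [NeZero n₂] (hm : 3 ≤ m) (h₁ : m ≤ n₁)
    (h₂ : m ≤ n₂) (c₁ : Site n₁) (c₂ : Site n₂) (s : ℕ) (A : Finset (Fin 3 → ℤ))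
    (hA : ∀ x ∈ A, ∀ y ∈ A, ∀ k, |x k - y k| + s ≤ m) :
    (fun t => localMean n₁ c₁ A t - localMean n₂ c₂ A t) =O[𝓝 0] fun t : ℂ => t ^ s := by
  induction s using Nat.strong_induction_on generalizing A with
  | _ s ih =>
  have hbase : ∀ A : Finset (Fin 3 → ℤ),
      (fun t => localMean n₁ c₁ A t - localMean n₂ c₂ A t) =O[𝓝 0] fun t : ℂ => (1 : ℂ) := by
    intro A
    refine Asymptotics.IsBigO.of_bound 2 ?_
    filter_upwards [eventually_norm_lt_tRadius] with t ht
    have := norm_sub_le (localMean n₁ c₁ A t) (localMean n₂ c₂ A t)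
    have h1 := norm_localMean_le ht c₁ A
    have h2 := norm_localMean_le ht c₂ A
    simp only [norm_one]
    linarith
  rcases Nat.eq_zero_or_pos s with rfl | hs
  · simpa using hbase A
  rcases A.eq_empty_or_nonempty with rfl | ⟨i, hi⟩
  · refine (Asymptotics.isBigO_zero _ _).congr' ?_ EventuallyEq.rfl
    filter_upwards [eventually_norm_lt_tRadius] with t ht
    rw [localMean_empty ht, localMean_empty ht, sub_self]
  have hsm : s ≤ m := by
    have := hA i hi i hi 0
    simp at this
    omega
  have hinj₁ : Set.InjOn (toSite n₁ c₁) A := injOn_toSite c₁ fun x hx y hy k => by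
    have := hA x hx y hy k
    omega
  have hinj₂ : Set.InjOn (toSite n₂ c₂) A := injOn_toSite c₂ fun x hx y hy k => by
    have := hA x hx y hy k
    omega
  have e : (fun t => localMean n₁ c₁ A t - localMean n₂ c₂ A t) = fun t =>
      -∑ B ∈ univ.erase (∅ : Finset Dir), (-t) ^ #B *
        (localMean n₁ c₁ (symmDiff A (starSupport i B)) t -
          localMean n₂ c₂ (symmDiff A (starSupport i B)) t) := by
    ext t
    rw [localMean_eq (hm.trans h₁) c₁ hinj₁ hi, localMean_eq (hm.trans h₂) c₂ hinj₂ hi]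
    simp only [mul_sub, sum_sub_distrib]
    ring
  rw [e]
  refine (Asymptotics.IsBigO.fun_sum fun B hB => ?_).neg_left
  have hB0 : B ≠ ∅ := ne_of_mem_erase hB
  have hBpos : 0 < #B := card_pos.2 (nonempty_iff_ne_empty.2 hB0)
  have hpow : (fun t : ℂ => (-t) ^ #B) =O[𝓝 0] fun t : ℂ => t ^ #B := by
    refine Asymptotics.IsBigO.of_bound 1 (Eventually.of_forall fun t => ?_)
    simp
  rcases le_or_gt s #B with hsB | hsB
  · have h1 : (fun t : ℂ => t ^ #B) =O[𝓝 0] fun t : ℂ => t ^ s := by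
      refine Asymptotics.IsBigO.of_bound 1 ?_
      filter_upwards [eventually_norm_lt_tRadius] with t ht
      rw [one_mul, norm_pow, norm_pow]
      exact pow_le_pow_of_le_one (norm_nonneg _) (ht.le.trans (tRadius_lt.le.trans (by norm_num)))
        hsB
    simpa using (hpow.trans h1).mul (hbase (symmDiff A (starSupport i B)))
  · have h2 := ih (s - #B) (by omega) (symmDiff A (starSupport i B)) ?_
    · have h3 := hpow.mul h2
      simp only [← pow_add] at h3
      rwa [Nat.add_sub_cancel' hsB.le] at h3
    · have hcast : ((s - #B : ℕ) : ℤ) = s - #B := by omega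
      have hmem : ∀ x ∈ symmDiff A (starSupport i B), x ∈ A ∨ ∃ p ∈ B, x = i + dirVec ℤ p := by
        intro x hx
        rcases mem_symmDiff.1 hx with h | h
        · exact Or.inl h.1
        · rcases mem_starSupport h.1 with rfl | h'
          · exact Or.inl hi
          · exact Or.inr h'
      have hB1 : (1 : ℤ) ≤ #B := by exact_mod_cast hBpos
      intro x hx y hy k
      rw [hcast]
      rcases hmem x hx with hx | ⟨p, hp, rfl⟩ <;> rcases hmem y hy with hy | ⟨q, hq, rfl⟩
      · have := hA x hx y hy k
        omega
      · have h3 := hA x hx i hi k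
        have h4 := natAbs_dirVec_le q k
        simp only [Pi.add_apply]
        rw [abs_le] at h4
        have h5 : |x k - (i k + dirVec ℤ q k)| ≤ |x k - i k| + 1 := by
          rw [abs_le]
          have := abs_le.1 (le_refl |x k - i k|)
          constructor <;> linarith
        omega
      · have h3 := hA i hi y hy k
        have h4 := natAbs_dirVec_le p k
        simp only [Pi.add_apply]
        rw [abs_le] at h4
        have h5 : |i k + dirVec ℤ p k - y k| ≤ |i k - y k| + 1 := by
          rw [abs_le]
          have := abs_le.1 (le_refl |i k - y k|)
          constructor <;> linarith
        omega
      · rcases eq_or_ne p q with rfl | hpq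
        · simp; omega
        · have h6 : 2 ≤ #B := by
            rw [← card_pair hpq]
            exact card_le_card (by simp [insert_subset_iff, hp, hq])
          have h3 := abs_le.1 (natAbs_dirVec_le p k)
          have h4 := abs_le.1 (natAbs_dirVec_le q k)
          have h5 : |(i + dirVec ℤ p) k - (i + dirVec ℤ q) k| ≤ 2 := by
            simp only [Pi.add_apply]
            rw [abs_le]
            constructor <;> linarith
          omega

end Torus

section FreeEnergy

open Finset

variable (n : ℕ) [NeZero n]

/-- The derivative of the reduced free energy per site with respect to `t`. -/
def freeEnergyDeriv (t : ℂ) : ℂ :=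
  -(1 - t ^ 2)⁻¹ * ((∑ e ∈ (torusGraph n).edgeFinset, torusSum n (fun σ => bond σ e) t) /
    torusSum n (fun _ => 1) t / (n : ℂ) ^ 3)

lemma differentiable_torusSum (f : (Site n → ℤˣ) → ℂ) : Differentiable ℂ (torusSum n f) := by
  unfold torusSum gibbsSum weight
  fun_prop

variable {n}

lemma one_sub_sq_ne_zero {t : ℂ} (ht : ‖t‖ < 1) : 1 - t ^ 2 ≠ 0 := by
  intro h
  have h1 : t ^ 2 = 1 := by linear_combination -h
  have h2 : ‖t‖ ^ 2 = 1 := by rw [← norm_pow, h1, norm_one]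
  nlinarith [norm_nonneg t]

lemma norm_lt_one_of_lt_tRadius {t : ℂ} (ht : ‖t‖ < tRadius) : ‖t‖ < 1 :=
  ht.trans (tRadius_lt.trans (by norm_num))

lemma differentiableOn_freeEnergyDeriv :
    DifferentiableOn ℂ (freeEnergyDeriv n) (Metric.ball 0 tRadius) := by
  intro t ht
  have ht' : ‖t‖ < tRadius := by simpa using ht
  refine DifferentiableAt.differentiableWithinAt ?_
  have h1 := one_sub_sq_ne_zero (norm_lt_one_of_lt_tRadius ht')
  have h2 := torusSum_one_ne_zero (n := n) ht'
  have h3 := fun f => differentiable_torusSum n f t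
  have hs : DifferentiableAt ℂ
      (fun t => ∑ e ∈ (torusGraph n).edgeFinset, torusSum n (fun σ => bond σ e) t) t :=
    DifferentiableAt.fun_sum fun e _ => h3 _
  unfold freeEnergyDeriv
  have hi : DifferentiableAt ℂ (fun t : ℂ => -(1 - t ^ 2)⁻¹) t := by
    have hp : DifferentiableAt ℂ (fun t : ℂ => 1 - t ^ 2) t := by fun_prop
    exact (hp.inv h1).neg
  exact hi.mul ((hs.div (h3 _) h2).div_const _)

lemma exists_bond_eq_character {e : Sym2 (Site n)} (he : e ∈ (torusGraph n).edgeFinset) :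
    ∃ A : Finset (Site n), A.Nonempty ∧ (fun σ => bond σ e) = character A := by
  induction e with
  | _ i j =>
    have hij : i ≠ j := (torusGraph n).ne_of_adj (by simpa using he)
    exact ⟨{i, j}, by simp, by ext; simp [character, prod_pair hij]⟩

lemma card_edgeFinset_le : (#(torusGraph n).edgeFinset : ℝ) ≤ 3 * (n : ℝ) ^ 3 := by
  have h := SimpleGraph.sum_degrees_eq_twice_card_edges (torusGraph n)
  have h2 : ∑ v, (torusGraph n).degree v ≤ ∑ _v : Site n, 6 :=
    sum_le_sum fun v _ => degree_torusGraph_le n v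
  rw [h] at h2
  simp only [sum_const, card_univ, Fintype.card_fun, ZMod.card, Fintype.card_fin,
    smul_eq_mul] at h2
  have h3 : #(torusGraph n).edgeFinset ≤ 3 * n ^ 3 := by omega
  exact_mod_cast h3

lemma norm_freeEnergyDeriv_le {t : ℂ} (ht : ‖t‖ < tRadius) : ‖freeEnergyDeriv n t‖ ≤ 4 := by
  have hZ : 0 < ‖torusSum n (fun _ => 1) t‖ := norm_pos_iff.2 (torusSum_one_ne_zero ht)
  have hn : (0 : ℝ) < (n : ℝ) ^ 3 := by
    have := Nat.pos_of_neZero n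
    positivity
  have h1 : ‖∑ e ∈ (torusGraph n).edgeFinset, torusSum n (fun σ => bond σ e) t‖ ≤
      3 * (n : ℝ) ^ 3 * ‖torusSum n (fun _ => 1) t‖ := by
    calc _ ≤ ∑ e ∈ (torusGraph n).edgeFinset, ‖torusSum n (fun _ => 1) t‖ := by
          refine norm_sum_le_of_le _ fun e he => ?_
          obtain ⟨A, -, hA⟩ := exists_bond_eq_character he
          rw [hA]
          exact norm_torusSum_character_le ht A
      _ ≤ _ := by
          rw [sum_const, nsmul_eq_mul]
          exact mul_le_mul_of_nonneg_right card_edgeFinset_le hZ.le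
  have h2 : (3 / 4 : ℝ) ≤ ‖1 - t ^ 2‖ := by
    have := norm_sub_norm_le (1 : ℂ) (t ^ 2)
    rw [norm_one, norm_pow] at this
    have h3 := tRadius_lt
    nlinarith [norm_nonneg t]
  rw [freeEnergyDeriv, norm_mul, norm_neg, norm_inv, norm_div, norm_div, norm_pow,
    Complex.norm_natCast]
  have h4 : ‖∑ e ∈ (torusGraph n).edgeFinset, torusSum n (fun σ => bond σ e) t‖ /
      ‖torusSum n (fun _ => 1) t‖ / (n : ℝ) ^ 3 ≤ 3 := by
    rw [div_le_iff₀ hn, div_le_iff₀ hZ]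
    exact h1
  have h5 : ‖1 - t ^ 2‖⁻¹ ≤ 4 / 3 := by
    rw [inv_le_comm₀ (by linarith) (by norm_num)]
    linarith
  calc _ ≤ (4 / 3 : ℝ) * 3 := mul_le_mul h5 h4 (by positivity) (by norm_num)
    _ = 4 := by norm_num

lemma freeEnergyDeriv_zero : freeEnergyDeriv n 0 = 0 := by
  have : ∑ e ∈ (torusGraph n).edgeFinset, torusSum n (fun σ => bond σ e) 0 = 0 := by
    refine sum_eq_zero fun e he => ?_
    obtain ⟨A, hA, h⟩ := exists_bond_eq_character he
    rw [h, torusSum_character_zero hA]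
  simp [freeEnergyDeriv, this]

lemma conj_cspin {V : Type*} (σ : V → ℤˣ) (i : V) : star (cspin σ i) = cspin σ i := by
  simp [cspin]

lemma conj_bond {V : Type*} (σ : V → ℤˣ) (e : Sym2 V) : star (bond σ e) = bond σ e := by
  induction e with
  | _ i j => rw [bond_mk, star_mul', conj_cspin, conj_cspin]

lemma star_torusSum (f : (Site n → ℤˣ) → ℂ) (hf : ∀ σ, star (f σ) = f σ) (x : ℝ) :
    star (torusSum n f x) = torusSum n f x := by
  have hx : star (x : ℂ) = x := Complex.conj_ofReal x
  simp only [torusSum, gibbsSum, weight, star_sum, star_mul', star_prod, star_add, star_one, hf,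
    conj_bond, hx]

lemma im_freeEnergyDeriv (x : ℝ) : (freeEnergyDeriv n x).im = 0 := by
  rw [← Complex.conj_eq_iff_im]
  change star (freeEnergyDeriv n x) = _
  have hx : star (x : ℂ) = x := Complex.conj_ofReal x
  have hn : star (n : ℂ) = n := star_natCast n
  simp only [freeEnergyDeriv, star_mul', star_neg, star_inv₀, star_sub, star_one, star_pow, hx,
    star_div₀, star_sum, hn, star_torusSum (fun _ => 1) (by simp), star_torusSum _
      fun σ => conj_bond σ _]

lemma torusSum_sum_bond (hn : 3 ≤ n) (t : ℂ) :
    (∑ e ∈ (torusGraph n).edgeFinset, torusSum n (fun σ => bond σ e) t) /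
      torusSum n (fun _ => 1) t =
    (∑ x : Site n, ∑ p : Dir, localMean n x {0, dirVec ℤ p} t) / 2 := by
  have h := sum_sum_neighborFinset (torusGraph n) fun e => torusSum n (fun σ => bond σ e) t
  have h2 : ∑ e ∈ (torusGraph n).edgeFinset, torusSum n (fun σ => bond σ e) t =
      (∑ i, ∑ b ∈ (torusGraph n).neighborFinset i, torusSum n (fun σ => bond σ s(i, b)) t) / 2 := by
    rw [h]; ring
  rw [h2, div_right_comm, sum_div]
  congr 1
  refine sum_congr rfl fun x _ => ?_
  rw [neighborFinset_eq hn, sum_image fun p _ q _ h => add_dirVec_injective hn _ h, sum_div]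
  refine sum_congr rfl fun p _ => ?_
  rw [localMean]
  congr 2
  ext σ
  rw [localObs, prod_pair (dirVec_ne_zero p).symm, bond_mk]
  have h0 : toSite n x 0 = x := by ext; simp [toSite]
  have h1 : toSite n x (dirVec ℤ p) = x + dirVec (ZMod n) p := by
    rw [← zero_add (dirVec ℤ p), toSite_add_dirVec, h0]
  rw [h0, h1]

lemma freeEnergyDeriv_eq (hn : 3 ≤ n) {m : ℕ} [NeZero m] (t : ℂ) :
    freeEnergyDeriv n t + (1 - t ^ 2)⁻¹ * ((∑ p : Dir, localMean m 0 {0, dirVec ℤ p} t) / 2) =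
    -(1 - t ^ 2)⁻¹ * ((∑ x : Site n, ∑ p : Dir, (localMean n x {0, dirVec ℤ p} t -
      localMean m 0 {0, dirVec ℤ p} t)) / 2 / (n : ℂ) ^ 3) := by
  have hn0 : (n : ℂ) ≠ 0 := by exact_mod_cast NeZero.ne n
  simp only [sum_sub_distrib, sum_const, card_univ, Fintype.card_fun, ZMod.card, Fintype.card_fin,
    nsmul_eq_mul]
  rw [freeEnergyDeriv, torusSum_sum_bond hn]
  push_cast
  field_simp
  ring

lemma inv_one_sub_sq_isBigO :
    (fun t : ℂ => -(1 - t ^ 2)⁻¹) =O[𝓝 0] fun _ => (1 : ℂ) := by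
  have : ContinuousAt (fun t : ℂ => -(1 - t ^ 2)⁻¹) 0 := by
    refine (ContinuousAt.inv₀ (by fun_prop) (by simp)).neg
  exact this.isBigO_one ℂ

lemma freeEnergyDeriv_add_isBigO {m : ℕ} [NeZero m] {k : ℕ} (hk : 3 ≤ k) (hn : k ≤ n)
    (hm : k ≤ m) :
    (fun t => freeEnergyDeriv n t +
      (1 - t ^ 2)⁻¹ * ((∑ p : Dir, localMean m 0 {0, dirVec ℤ p} t) / 2)) =O[𝓝 0]
      fun t : ℂ => t ^ (k - 1) := by
  simp only [freeEnergyDeriv_eq (hk.trans hn)]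
  have h1 : ∀ x : Site n, ∀ p : Dir, (fun t => localMean n x {0, dirVec ℤ p} t -
      localMean m 0 {0, dirVec ℤ p} t) =O[𝓝 0] fun t : ℂ => t ^ (k - 1) := by
    intro x p
    refine localMean_sub_isBigO hk hn hm x 0 (k - 1) _ ?_
    have hc : ((k - 1 : ℕ) : ℤ) = k - 1 := by omega
    intro a ha b hb j
    have h2 := natAbs_dirVec_le p j
    have h3 : |a j - b j| ≤ 1 := by
      simp only [mem_insert, mem_singleton] at ha hb
      rcases ha with rfl | rfl <;> rcases hb with rfl | rfl <;> simp [h2]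
    omega
  have h2 : (fun t => ∑ x : Site n, ∑ p : Dir, (localMean n x {0, dirVec ℤ p} t -
      localMean m 0 {0, dirVec ℤ p} t)) =O[𝓝 0] fun t : ℂ => t ^ (k - 1) :=
    Asymptotics.IsBigO.fun_sum fun x _ => Asymptotics.IsBigO.fun_sum fun p _ => h1 x p
  have h3 := inv_one_sub_sq_isBigO.mul
    ((h2.const_mul_left ((2 : ℂ)⁻¹)).const_mul_left (((n : ℂ) ^ 3)⁻¹))
  simp only [one_mul] at h3
  refine h3.congr_left fun t => ?_
  ring

lemma isBigO_pow_of_le {a b : ℕ} (h : a ≤ b) :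
    (fun t : ℂ => t ^ b) =O[𝓝 0] fun t : ℂ => t ^ a := by
  refine Asymptotics.IsBigO.of_bound 1 ?_
  filter_upwards [eventually_norm_lt_tRadius] with t ht
  rw [one_mul, norm_pow, norm_pow]
  exact pow_le_pow_of_le_one (norm_nonneg _) (norm_lt_one_of_lt_tRadius ht).le h

theorem freeEnergyDeriv_sub_isBigO {m : ℕ} [NeZero m] (h : n ≤ m) :
    (fun t => freeEnergyDeriv n t - freeEnergyDeriv m t) =O[𝓝 0] fun t : ℂ => t ^ (n - 1) := by
  rcases lt_or_ge n 3 with hn | hn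
  · have h0 : Metric.ball (0 : ℂ) tRadius ∈ 𝓝 0 := Metric.ball_mem_nhds _ tRadius_pos
    have hd : DifferentiableAt ℂ (fun t => freeEnergyDeriv n t - freeEnergyDeriv m t) 0 :=
      ((differentiableOn_freeEnergyDeriv.differentiableAt h0).sub
        (differentiableOn_freeEnergyDeriv.differentiableAt h0))
    have h1 := hd.isBigO_sub
    simp only [freeEnergyDeriv_zero, sub_zero] at h1
    have h2 := isBigO_pow_of_le (a := n - 1) (b := 1) (by omega)
    simp only [pow_one] at h2
    exact h1.trans h2
  · have h1 := freeEnergyDeriv_add_isBigO (n := n) (m := n) hn le_rfl le_rfl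
    have h2 := freeEnergyDeriv_add_isBigO (n := m) (m := n) hn h le_rfl
    refine (h1.sub h2).congr_left fun t => ?_
    ring

variable (n) in
lemma exists_primitive_freeEnergyDeriv :
    ∃ G : ℂ → ℂ, G 0 = -(Real.log 2 : ℂ) ∧
      ∀ t ∈ Metric.ball (0 : ℂ) tRadius, HasDerivAt G (freeEnergyDeriv n t) t :=
  (differentiableOn_freeEnergyDeriv (n := n)).isExactOn_ball.with_val_at _ _

variable (n) in
/-- The reduced free energy per site as an analytic function of `t`. -/
def freeEnergy : ℂ → ℂ := (exists_primitive_freeEnergyDeriv n).choose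

lemma freeEnergy_zero : freeEnergy n 0 = -(Real.log 2 : ℂ) :=
  (exists_primitive_freeEnergyDeriv n).choose_spec.1

lemma hasDerivAt_freeEnergy {t : ℂ} (ht : ‖t‖ < tRadius) :
    HasDerivAt (freeEnergy n) (freeEnergyDeriv n t) t :=
  (exists_primitive_freeEnergyDeriv n).choose_spec.2 t (by simpa using ht)

lemma differentiableOn_freeEnergy :
    DifferentiableOn ℂ (freeEnergy n) (Metric.ball 0 tRadius) := fun t ht =>
  (hasDerivAt_freeEnergy (by simpa using ht)).differentiableAt.differentiableWithinAt

lemma norm_freeEnergy_le {t : ℂ} (ht : ‖t‖ < tRadius) : ‖freeEnergy n t‖ ≤ 2 := by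
  have h := Convex.norm_image_sub_le_of_norm_hasDerivWithin_le (C := 4) (f := freeEnergy n)
    (f' := freeEnergyDeriv n)
    (fun x hx => (hasDerivAt_freeEnergy (n := n) (by simpa using hx)).hasDerivWithinAt)
    (fun x hx => norm_freeEnergyDeriv_le (by simpa using hx)) (convex_ball (0 : ℂ) tRadius)
    (Metric.mem_ball_self tRadius_pos) (by simpa using ht : t ∈ Metric.ball (0 : ℂ) tRadius)
  rw [freeEnergy_zero, sub_zero, sub_neg_eq_add] at h
  have h1 : ‖(Real.log 2 : ℂ)‖ ≤ 1 := by
    rw [Complex.norm_real, Real.norm_of_nonneg (Real.log_nonneg (by norm_num))]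
    have := Real.log_two_lt_d9
    linarith
  have h2 := norm_sub_le (freeEnergy n t + (Real.log 2 : ℂ)) (Real.log 2 : ℂ)
  rw [add_sub_cancel_right] at h2
  have := tRadius_lt
  linarith

lemma im_freeEnergy {x : ℝ} (hx : |x| < tRadius) : (freeEnergy n x).im = 0 := by
  have hd : ∀ y ∈ Set.Ioo (-tRadius) tRadius,
      HasDerivAt (fun y : ℝ => (freeEnergy n y).im) 0 y := by
    intro y hy
    have hy' : ‖(y : ℂ)‖ < tRadius := by simpa using abs_lt.2 hy
    have h2 : HasDerivAt (fun y : ℝ => (freeEnergy n y).im) (freeEnergyDeriv n y).im y :=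
      Complex.imCLM.hasFDerivAt.comp_hasDerivAt y (hasDerivAt_freeEnergy hy').comp_ofReal
    rwa [im_freeEnergyDeriv] at h2
  have h := isOpen_Ioo.is_const_of_deriv_eq_zero isPreconnected_Ioo
    (fun y hy => (hd y hy).differentiableAt.differentiableWithinAt)
    (fun y hy => (hd y hy).deriv) (abs_lt.1 hx)
    (⟨by linarith [tRadius_pos], tRadius_pos⟩ : (0 : ℝ) ∈ Set.Ioo (-tRadius) tRadius)
  rw [h]
  simp only [Complex.ofReal_zero, freeEnergy_zero, Complex.neg_im, Complex.ofReal_im, neg_zero]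

lemma isBigO_pow_succ_of_hasDerivAt {f f' : ℂ → ℂ} {R : ℝ} (hR : 0 < R) {k : ℕ} (h0 : f 0 = 0)
    (hd : ∀ z : ℂ, ‖z‖ < R → HasDerivAt f (f' z) z) (hO : f' =O[𝓝 0] fun z : ℂ => z ^ k) :
    f =O[𝓝 0] fun z : ℂ => z ^ (k + 1) := by
  obtain ⟨c, hc0, hc⟩ := hO.exists_nonneg
  obtain ⟨ε, hε, hb⟩ := Metric.eventually_nhds_iff.1 hc.bound
  refine Asymptotics.IsBigO.of_bound c ?_
  filter_upwards [Metric.ball_mem_nhds (0 : ℂ) (lt_min hε hR)] with z hz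
  have hz' : ‖z‖ < min ε R := by simpa using hz
  have h := Convex.norm_image_sub_le_of_norm_hasDerivWithin_le (C := c * ‖z‖ ^ k) (f := f)
    (f' := f') (s := Metric.closedBall (0 : ℂ) ‖z‖) (x := 0) (y := z)
    (fun x hx => (hd x ?_).hasDerivWithinAt)
    (fun x hx => ?_) (convex_closedBall _ _) (by simp) (by simp)
  · rw [h0, sub_zero, sub_zero] at h
    rw [norm_pow, pow_succ, ← mul_assoc]
    exact h
  · have hx' : ‖x‖ ≤ ‖z‖ := by simpa using hx
    exact hx'.trans_lt (hz'.trans_le (min_le_right _ _))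
  · have hx' : ‖x‖ ≤ ‖z‖ := by simpa using hx
    have h1 := hb (y := x) (by simpa using hx'.trans_lt (hz'.trans_le (min_le_left _ _)))
    rw [norm_pow] at h1
    exact h1.trans (by gcongr)

theorem freeEnergy_sub_isBigO {m : ℕ} [NeZero m] (h : n ≤ m) :
    (fun t => freeEnergy n t - freeEnergy m t) =O[𝓝 0] fun t : ℂ => t ^ n := by
  have h1 := isBigO_pow_succ_of_hasDerivAt (f := fun t => freeEnergy n t - freeEnergy m t)
    tRadius_pos (by simp [freeEnergy_zero])
    (fun z hz => (hasDerivAt_freeEnergy hz).sub (hasDerivAt_freeEnergy hz))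
    (freeEnergyDeriv_sub_isBigO h)
  rwa [Nat.sub_add_cancel (Nat.pos_of_neZero n)] at h1

end FreeEnergy

/-! ### The hyperbolic tangent in the complex domain -/

section Tanh

lemma cosh_ne_zero_of_abs_im_lt {K : ℂ} (hK : |K.im| < Real.pi / 2) : Complex.cosh K ≠ 0 := by
  intro h
  have h1 : (Complex.cosh K).re = 0 := by rw [h]; rfl
  rw [← Complex.re_add_im K, Complex.cosh_add, Complex.cosh_mul_I, Complex.sinh_mul_I,
    ← Complex.ofReal_cosh, ← Complex.ofReal_cos, ← Complex.ofReal_sinh, ← Complex.ofReal_sin] at h1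
  simp only [Complex.add_re, Complex.mul_re, Complex.ofReal_re, Complex.ofReal_im, Complex.mul_im,
    Complex.I_re, Complex.I_im] at h1
  have h2 := Real.cosh_pos K.re
  have h3 := Real.cos_pos_of_mem_Ioo (abs_lt.1 hK)
  nlinarith [mul_pos h2 h3]

lemma cos_mul_exp_antitoneOn :
    AntitoneOn (fun s : ℝ => Real.cos s * Real.exp (s ^ 2 / 2)) (Set.Icc 0 (Real.pi / 2)) := by
  have hd : ∀ s : ℝ, HasDerivAt (fun s : ℝ => Real.cos s * Real.exp (s ^ 2 / 2))
      ((s * Real.cos s - Real.sin s) * Real.exp (s ^ 2 / 2)) s := by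
    intro s
    have h1 : HasDerivAt (fun s : ℝ => s ^ 2 / 2) s s := by
      have := (hasDerivAt_pow 2 s).div_const 2
      simpa using this
    have h2 := (Real.hasDerivAt_cos s).mul h1.exp
    exact h2.congr_deriv (by ring)
  refine antitoneOn_of_deriv_nonpos (convex_Icc _ _)
    (fun s _ => (hd s).continuousAt.continuousWithinAt)
    (fun s _ => (hd s).differentiableAt.differentiableWithinAt) fun s hs => ?_
  rw [interior_Icc] at hs
  rw [(hd s).deriv]
  have h1 := Real.lt_tan hs.1 hs.2
  have h2 : 0 < Real.cos s := Real.cos_pos_of_mem_Ioo ⟨by linarith [hs.1, Real.pi_pos], hs.2⟩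
  rw [Real.tan_eq_sin_div_cos, lt_div_iff₀ h2] at h1
  have := Real.exp_pos (s ^ 2 / 2)
  nlinarith

lemma cos_mul_cosh_lt {x y a : ℝ} (ha : 0 < a) (ha' : a < Real.pi / 2)
    (h : x ^ 2 + y ^ 2 < a ^ 2) : Real.cos a * Real.cosh x < Real.cos y := by
  have hy : |y| < a := abs_lt_of_sq_lt_sq (by nlinarith [sq_nonneg x]) ha.le
  have h1 := cos_mul_exp_antitoneOn ⟨abs_nonneg y, by linarith⟩ ⟨ha.le, ha'.le⟩ hy.le
  simp only [Real.cos_abs, sq_abs] at h1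
  have hc : 0 < Real.cos a := Real.cos_pos_of_mem_Ioo ⟨by linarith, ha'⟩
  have h2 : Real.exp (x ^ 2 / 2) * Real.exp (y ^ 2 / 2) < Real.exp (a ^ 2 / 2) := by
    rw [← Real.exp_add]
    exact Real.exp_lt_exp.2 (by linarith)
  have h3 := Real.cosh_le_exp_half_sq x
  have h4 := Real.exp_pos (y ^ 2 / 2)
  have h5 : Real.cos a * Real.cosh x * Real.exp (y ^ 2 / 2) <
      Real.cos y * Real.exp (y ^ 2 / 2) := by
    calc _ = Real.cos a * (Real.cosh x * Real.exp (y ^ 2 / 2)) := by ring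
      _ ≤ Real.cos a * (Real.exp (x ^ 2 / 2) * Real.exp (y ^ 2 / 2)) := by gcongr
      _ < Real.cos a * Real.exp (a ^ 2 / 2) := by gcongr
      _ ≤ _ := h1
  exact lt_of_mul_lt_mul_right h5 h4.le

lemma abs_im_lt_of_norm_lt_kRadius {K : ℂ} (hK : ‖K‖ < kRadius) : |K.im| < Real.pi / 2 := by
  have h := Complex.abs_im_le_norm K
  rw [kRadius_eq] at hK
  linarith [Real.pi_pos]

lemma norm_tanh_lt {K : ℂ} (hK : ‖K‖ < kRadius) : ‖Complex.tanh K‖ < tRadius := by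
  have hcosh := cosh_ne_zero_of_abs_im_lt (abs_im_lt_of_norm_lt_kRadius hK)
  have hr := tRadius_pos
  have hpi := Real.pi_pos
  have h1 : K.re ^ 2 + K.im ^ 2 < kRadius ^ 2 := by
    have h2 : ‖K‖ ^ 2 < kRadius ^ 2 := pow_lt_pow_left₀ hK (norm_nonneg _) two_ne_zero
    rwa [← Complex.normSq_eq_norm_sq, Complex.normSq_apply, ← sq, ← sq] at h2
  have h2 := cos_mul_cosh_lt (x := 2 * K.re) (y := 2 * K.im) (a := 2 * kRadius)
    (by linarith [kRadius_pos]) (by rw [kRadius_eq]; linarith) (by nlinarith)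
  have hcos : Real.cos (2 * kRadius) * (1 + tRadius ^ 2) = 1 - tRadius ^ 2 := by
    have h3 : Real.cos kRadius ^ 2 = 1 / (1 + tRadius ^ 2) := Real.cos_sq_arctan tRadius
    rw [Real.cos_two_mul, h3]
    field_simp
    ring
  rw [Complex.tanh_eq_sinh_div_cosh, norm_div, div_lt_iff₀ (norm_pos_iff.2 hcosh)]
  refine lt_of_pow_lt_pow_left₀ 2 (by positivity) ?_
  rw [mul_pow, ← Complex.normSq_eq_norm_sq, ← Complex.normSq_eq_norm_sq]
  have es : Complex.normSq (Complex.sinh K) = Real.sinh K.re ^ 2 + Real.sin K.im ^ 2 := by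
    rw [← Complex.re_add_im K, Complex.sinh_add, Complex.cosh_mul_I, Complex.sinh_mul_I,
      ← Complex.ofReal_cosh, ← Complex.ofReal_cos, ← Complex.ofReal_sinh, ← Complex.ofReal_sin,
      Complex.normSq_apply]
    simp only [Complex.add_re, Complex.mul_re, Complex.ofReal_re, Complex.ofReal_im,
      Complex.mul_im, Complex.I_re, Complex.I_im, Complex.add_im]
    have e1 := Real.cosh_sq K.re
    have e2 := Real.sin_sq_add_cos_sq K.im
    ring_nf
    rw [e1]
    linear_combination Real.sinh K.re ^ 2 * e2
  have ec : Complex.normSq (Complex.cosh K) = Real.sinh K.re ^ 2 + Real.cos K.im ^ 2 := by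
    rw [← Complex.re_add_im K, Complex.cosh_add, Complex.cosh_mul_I, Complex.sinh_mul_I,
      ← Complex.ofReal_cosh, ← Complex.ofReal_cos, ← Complex.ofReal_sinh, ← Complex.ofReal_sin,
      Complex.normSq_apply]
    simp only [Complex.add_re, Complex.mul_re, Complex.ofReal_re, Complex.ofReal_im,
      Complex.mul_im, Complex.I_re, Complex.I_im, Complex.add_im]
    have e1 := Real.cosh_sq K.re
    have e2 := Real.sin_sq_add_cos_sq K.im
    ring_nf
    rw [e1]
    linear_combination Real.sinh K.re ^ 2 * e2
  rw [es, ec]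
  have e1 := Real.cosh_two_mul K.re
  have e2 := Real.cosh_sq K.re
  have e3 := Real.cos_two_mul K.im
  have e4 := Real.sin_sq_add_cos_sq K.im
  have h5 : (1 - tRadius ^ 2) * Real.cosh (2 * K.re) <
      Real.cos (2 * K.im) * (1 + tRadius ^ 2) := by
    rw [← hcos]
    nlinarith [sq_nonneg tRadius]
  rw [e1, e2, e3] at h5
  nlinarith

/-- The inverse hyperbolic tangent in the unit disk. -/
def artanhC (t : ℂ) : ℂ := (Complex.log (1 + t) - Complex.log (1 - t)) / 2

lemma re_pos_of_norm_lt_one {t : ℂ} (ht : ‖t‖ < 1) : 0 < (1 + t).re ∧ 0 < (1 - t).re := by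
  have := abs_lt.1 ((Complex.abs_re_le_norm t).trans_lt ht)
  simp only [Complex.add_re, Complex.sub_re, Complex.one_re]
  constructor <;> linarith

lemma hasDerivAt_artanhC {t : ℂ} (ht : ‖t‖ < 1) : HasDerivAt artanhC (1 - t ^ 2)⁻¹ t := by
  obtain ⟨h1, h2⟩ := re_pos_of_norm_lt_one ht
  have h3 : (1 + t) ≠ 0 := fun h => by rw [h] at h1; simp at h1
  have h4 : (1 - t) ≠ 0 := fun h => by rw [h] at h2; simp at h2
  have d1 := ((hasDerivAt_id t).const_add 1).clog (Or.inl h1)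
  have d2 := ((hasDerivAt_id t).const_sub 1).clog (Or.inl h2)
  have d3 := (d1.sub d2).div_const 2
  refine d3.congr_deriv ?_
  have h5 : 1 - t ^ 2 = (1 + t) * (1 - t) := by ring
  rw [h5]
  simp only [id_eq]
  field_simp
  ring

lemma artanhC_zero : artanhC 0 = 0 := by simp [artanhC]

lemma exp_two_mul_artanhC {t : ℂ} (ht : ‖t‖ < 1) :
    Complex.exp (2 * artanhC t) * (1 - t) = 1 + t := by
  obtain ⟨h1, h2⟩ := re_pos_of_norm_lt_one ht
  have h3 : (1 + t) ≠ 0 := fun h => by rw [h] at h1; simp at h1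
  have h4 : (1 - t) ≠ 0 := fun h => by rw [h] at h2; simp at h2
  rw [artanhC, mul_div_cancel₀ _ two_ne_zero, Complex.exp_sub, Complex.exp_log h3,
    Complex.exp_log h4, div_mul_cancel₀ _ h4]

lemma abs_im_artanhC_lt {t : ℂ} (ht : ‖t‖ < 1) : |(artanhC t).im| < Real.pi / 2 := by
  obtain ⟨h1, h2⟩ := re_pos_of_norm_lt_one ht
  have a1 := abs_lt.1 (Complex.abs_arg_lt_pi_div_two_iff.2 (Or.inl h1))
  have a2 := abs_lt.1 (Complex.abs_arg_lt_pi_div_two_iff.2 (Or.inl h2))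
  have : (artanhC t).im = ((1 + t).arg - (1 - t).arg) / 2 := by
    rw [artanhC, show (2 : ℂ) = ((2 : ℝ) : ℂ) by norm_num, Complex.div_ofReal_im, Complex.sub_im,
      Complex.log_im, Complex.log_im]
  rw [this, abs_lt]
  constructor <;> linarith

lemma exp_two_mul_mul_one_sub_tanh {K : ℂ} (hK : Complex.cosh K ≠ 0) :
    Complex.exp (2 * K) * (1 - Complex.tanh K) = 1 + Complex.tanh K := by
  have h1 := Complex.cosh_add_sinh K
  have h2 := Complex.cosh_sub_sinh K
  have h3 : Complex.exp (2 * K) = Complex.exp K * Complex.exp K := by rw [← Complex.exp_add]; ring_nf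
  have h4 : Complex.exp K * Complex.exp (-K) = 1 := by rw [← Complex.exp_add]; simp
  rw [Complex.tanh_eq_sinh_div_cosh]
  field_simp
  rw [h1, h2, h3, mul_assoc, h4, mul_one]

lemma tanh_artanhC {t : ℂ} (ht : ‖t‖ < 1) : Complex.tanh (artanhC t) = t := by
  have h1 := exp_two_mul_artanhC ht
  have h2 := exp_two_mul_mul_one_sub_tanh (cosh_ne_zero_of_abs_im_lt (abs_im_artanhC_lt ht))
  have h3 : Complex.exp (2 * artanhC t) + 1 ≠ 0 := by
    intro h
    have h4 : Complex.exp (2 * artanhC t) = -1 := by linear_combination h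
    rw [h4] at h1
    have : (2 : ℂ) = 0 := by linear_combination -h1
    norm_num at this
  have h5 : (Complex.exp (2 * artanhC t) + 1) * (Complex.tanh (artanhC t) - t) = 0 := by
    linear_combination h1 - h2
  exact sub_eq_zero.1 ((mul_eq_zero.1 h5).resolve_left h3)

lemma artanhC_tanh {K : ℂ} (hK : |K.im| < Real.pi / 2) (ht : ‖Complex.tanh K‖ < 1) :
    artanhC (Complex.tanh K) = K := by
  have h1 := exp_two_mul_artanhC ht
  have h2 := exp_two_mul_mul_one_sub_tanh (cosh_ne_zero_of_abs_im_lt hK)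
  have h3 : 1 - Complex.tanh K ≠ 0 := by
    intro h
    have := (re_pos_of_norm_lt_one ht).2
    rw [h] at this
    simp at this
  have h4 := mul_right_cancel₀ h3 (h1.trans h2.symm)
  have a1 := abs_lt.1 (abs_im_artanhC_lt ht)
  have a2 := abs_lt.1 hK
  have h5 := Complex.exp_inj_of_neg_pi_lt_of_le_pi (by simp; linarith) (by simp; linarith)
    (by simp; linarith) (by simp; linarith) h4
  exact mul_left_cancel₀ two_ne_zero h5

lemma differentiableAt_tanh {K : ℂ} (hK : Complex.cosh K ≠ 0) :
    DifferentiableAt ℂ Complex.tanh K := by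
  have : Complex.tanh = fun z => Complex.sinh z / Complex.cosh z := by
    ext z; exact Complex.tanh_eq_sinh_div_cosh z
  rw [this]
  exact Complex.differentiable_sinh.differentiableAt.div
    Complex.differentiable_cosh.differentiableAt hK

end Tanh

section Partition

open Finset

variable {n : ℕ} [NeZero n]

/-- The interaction `∑ σ_i σ_j`. -/
def bondSum (σ : Site n → ℤˣ) : ℂ := ∑ e ∈ (torusGraph n).edgeFinset, bond σ e

lemma partitionFunction_eq (β J : ℂ) :
    partitionFunction n β J 0 = ∑ σ : Config n, Complex.exp (β * J * bondSum σ) := by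
  refine sum_congr rfl fun σ _ => ?_
  have : ∀ e : Sym2 (Site n), (e.map (spin ℂ σ)).mul = bond σ e := fun e => rfl
  simp only [energy, this, bondSum]
  ring_nf

lemma partitionFunction_ofReal (β J : ℝ) :
    partitionFunction n β J 0 = (realPartitionFunction n β J 0 : ℂ) := by
  simp only [partitionFunction, realPartitionFunction, energy]
  push_cast
  refine sum_congr rfl fun σ _ => ?_
  have : ∀ e : Sym2 (Site n), (((e.map (spin ℝ σ)).mul : ℝ) : ℂ) = (e.map (spin ℂ σ)).mul := by
    intro e
    induction e with
    | _ i j => simp [spin]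
  simp only [this, zero_mul]

lemma exp_mul_bondSum {K : ℂ} (hK : Complex.cosh K ≠ 0) (σ : Site n → ℤˣ) :
    Complex.exp (K * bondSum σ) = Complex.cosh K ^ #(torusGraph n).edgeFinset *
      weight (torusGraph n) (Complex.tanh K) σ := by
  rw [bondSum, mul_sum, Complex.exp_sum, weight, ← prod_const, ← prod_mul_distrib]
  refine prod_congr rfl fun e _ => ?_
  rw [Complex.tanh_eq_sinh_div_cosh]
  rcases mul_self_eq_one_iff.1 (bond_mul_self σ e) with h | h <;> rw [h] <;> field_simp
  · exact (Complex.cosh_add_sinh K).symm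
  · rw [← sub_eq_add_neg]; exact (Complex.cosh_sub_sinh K).symm

lemma sum_exp_mul_bondSum {K : ℂ} (hK : Complex.cosh K ≠ 0) :
    ∑ σ : Site n → ℤˣ, Complex.exp (K * bondSum σ) =
      Complex.cosh K ^ #(torusGraph n).edgeFinset * torusSum n (fun _ => 1) (Complex.tanh K) := by
  simp only [exp_mul_bondSum hK, torusSum, gibbsSum, mul_sum, one_mul]

lemma sum_bondSum_mul_exp {K : ℂ} (hK : Complex.cosh K ≠ 0) :
    ∑ σ : Site n → ℤˣ, Complex.exp (K * bondSum σ) * bondSum σ =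
      Complex.cosh K ^ #(torusGraph n).edgeFinset *
        ∑ e ∈ (torusGraph n).edgeFinset, torusSum n (fun σ => bond σ e) (Complex.tanh K) := by
  simp only [exp_mul_bondSum hK, torusSum, gibbsSum, mul_sum]
  rw [sum_comm (s := (torusGraph n).edgeFinset)]
  refine sum_congr rfl fun σ _ => ?_
  rw [bondSum, mul_sum]
  exact sum_congr rfl fun e _ => by ring

/-- The analytic free energy is a branch of the logarithm of the partition function. -/
theorem exp_freeEnergy {t : ℂ} (ht : ‖t‖ < tRadius) :
    Complex.exp (-(n : ℂ) ^ 3 * freeEnergy n t) =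
      ∑ σ : Site n → ℤˣ, Complex.exp (artanhC t * bondSum σ) := by
  let H : ℂ → ℂ := fun t => Complex.exp ((n : ℂ) ^ 3 * freeEnergy n t) *
    ∑ σ : Site n → ℤˣ, Complex.exp (artanhC t * bondSum σ)
  have hn : (n : ℂ) ≠ 0 := by exact_mod_cast NeZero.ne n
  have hd : ∀ s ∈ Metric.ball (0 : ℂ) tRadius, HasDerivAt H 0 s := by
    intro s hs
    have hs' : ‖s‖ < tRadius := by simpa using hs
    have hs1 := norm_lt_one_of_lt_tRadius hs'
    have hcosh := cosh_ne_zero_of_abs_im_lt (abs_im_artanhC_lt hs1)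
    have d1 := ((hasDerivAt_freeEnergy (n := n) hs').const_mul ((n : ℂ) ^ 3)).cexp
    have d2 : HasDerivAt (fun t => ∑ σ : Site n → ℤˣ, Complex.exp (artanhC t * bondSum σ))
        (∑ σ : Site n → ℤˣ,
          Complex.exp (artanhC s * bondSum σ) * ((1 - s ^ 2)⁻¹ * bondSum σ)) s :=
      HasDerivAt.fun_sum fun σ _ => ((hasDerivAt_artanhC hs1).mul_const (bondSum σ)).cexp
    refine (d1.mul d2).congr_deriv ?_
    have e1 : ∑ σ : Site n → ℤˣ,
        Complex.exp (artanhC s * bondSum σ) * ((1 - s ^ 2)⁻¹ * bondSum σ) = (1 - s ^ 2)⁻¹ *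
        ∑ σ : Site n → ℤˣ, Complex.exp (artanhC s * bondSum σ) * bondSum σ := by
      rw [mul_sum]
      exact sum_congr rfl fun σ _ => by ring
    rw [e1, sum_bondSum_mul_exp hcosh, sum_exp_mul_bondSum hcosh, tanh_artanhC hs1,
      freeEnergyDeriv]
    have hZ := torusSum_one_ne_zero (n := n) hs'
    field_simp
    ring
  have hconst : H t = H 0 :=
    Metric.isOpen_ball.is_const_of_deriv_eq_zero (convex_ball (0 : ℂ) tRadius).isPreconnected
      (fun s hs => (hd s hs).differentiableAt.differentiableWithinAt)
      (fun s hs => (hd s hs).deriv) (by simpa using ht) (Metric.mem_ball_self tRadius_pos)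
  have h0 : H 0 = 1 := by
    have hc : (Fintype.card (Site n → ℤˣ) : ℂ) = 2 ^ (n ^ 3) := by
      simp [ZMod.card]
    simp only [H, artanhC_zero, zero_mul, Complex.exp_zero, sum_const, card_univ, nsmul_eq_mul,
      mul_one, hc, freeEnergy_zero]
    have h2 : Complex.exp (-(Real.log 2 : ℂ)) = 2⁻¹ := by
      rw [Complex.exp_neg, ← Complex.ofReal_exp, Real.exp_log (by norm_num)]
      norm_num
    rw [← Nat.cast_pow, Complex.exp_nat_mul, h2, ← mul_pow]
    norm_num
  rw [h0] at hconst
  rw [neg_mul, Complex.exp_neg]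
  exact inv_eq_of_mul_eq_one_right hconst

theorem exp_freeEnergy_tanh {β J : ℂ} (him : |(β * J).im| < Real.pi / 2)
    (ht : ‖Complex.tanh (β * J)‖ < tRadius) :
    Complex.exp (-(n : ℂ) ^ 3 * freeEnergy n (Complex.tanh (β * J))) =
      partitionFunction n β J 0 := by
  rw [exp_freeEnergy ht, artanhC_tanh him (norm_lt_one_of_lt_tRadius ht), partitionFunction_eq]

lemma finiteReducedFreeEnergy_eq {β J : ℝ} (ht : |Real.tanh (β * J)| < tRadius) :
    (finiteReducedFreeEnergy n β J 0 : ℂ) = freeEnergy n (Real.tanh (β * J)) := by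
  have hn : (n : ℝ) ^ 3 ≠ 0 := pow_ne_zero _ (by exact_mod_cast NeZero.ne n)
  have h := exp_freeEnergy_tanh (n := n) (β := β) (J := J)
    (by rw [← Complex.ofReal_mul, Complex.ofReal_im, abs_zero]; exact Real.pi_div_two_pos)
    (by rw [← Complex.ofReal_mul, ← Complex.ofReal_tanh, Complex.norm_real]; exact ht)
  have him := im_freeEnergy (n := n) ht
  have hre : (((freeEnergy n (Real.tanh (β * J))).re : ℝ) : ℂ) =
      freeEnergy n (Real.tanh (β * J)) := by
    apply Complex.ext
    · simp
    · rw [him]; simp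
  rw [partitionFunction_ofReal, ← Complex.ofReal_mul, ← Complex.ofReal_tanh, ← hre] at h
  have h2 : Real.exp (-(n : ℝ) ^ 3 * (freeEnergy n (Real.tanh (β * J))).re) =
      realPartitionFunction n β J 0 := by
    exact_mod_cast h
  rw [← hre, finiteReducedFreeEnergy, ← h2, Real.log_exp]
  congr 1
  rw [neg_mul (_ ^ 3), neg_mul_neg, ← mul_assoc, one_div, inv_mul_cancel₀ hn, one_mul]

end Partition

section Main

lemma exists_freeEnergy_tanhSeries :
    ∃ (G : WithTop ℕ+ → ℂ → ℂ) (a : WithTop ℕ+ → ℕ → ℝ), (∀ n : ℕ+, G n = freeEnergy n) ∧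
      (∀ z ∈ Metric.ball (0 : ℂ) tRadius,
        Tendsto (fun n : ℕ+ => freeEnergy n z) atTop (𝓝 (G ⊤ z))) ∧
      (∀ N, HasFPowerSeriesOnBall (G N)
        (FormalMultilinearSeries.ofScalars ℂ fun k => (a N k : ℂ)) 0 (ENNReal.ofReal tRadius)) ∧
      (∀ ρ < tRadius, TendstoUniformlyOn
        (fun (m : ℕ) (p : WithTop ℕ+ × ℂ) => ∑ k ∈ Finset.range m, (a p.1 k : ℂ) * p.2 ^ k)
        (fun p => G p.1 p.2) atTop (Set.univ ×ˢ Metric.closedBall (0 : ℂ) ρ)) ∧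
      (∀ (n : ℕ+) (k : ℕ), k < (n : ℕ) → a n k = a ⊤ k) :=
  exists_limit_of_isBigO_sub (C := 2) tRadius_pos (fun n : ℕ+ => freeEnergy n)
    (fun _ => differentiableOn_freeEnergy)
    (fun _ _ hz => norm_freeEnergy_le (by simpa using hz)) (fun _ _ hx => im_freeEnergy hx)
    (fun _ _ h => freeEnergy_sub_isBigO h)

lemma tanh_isBigO : Complex.tanh =O[𝓝 0] fun z : ℂ => z := by
  have h := (differentiableAt_tanh (K := 0) (by simp)).isBigO_sub
  simpa using h

lemma exists_freeEnergy_series :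
    ∃ (F : WithTop ℕ+ → ℂ → ℂ) (b : WithTop ℕ+ → ℕ → ℝ),
      (∀ n : ℕ+, F n = fun K => freeEnergy n (Complex.tanh K)) ∧
      (∀ z ∈ Metric.ball (0 : ℂ) kRadius,
        Tendsto (fun n : ℕ+ => freeEnergy n (Complex.tanh z)) atTop (𝓝 (F ⊤ z))) ∧
      (∀ N, HasFPowerSeriesOnBall (F N)
        (FormalMultilinearSeries.ofScalars ℂ fun k => (b N k : ℂ)) 0 (ENNReal.ofReal kRadius)) ∧
      (∀ ρ < kRadius, TendstoUniformlyOn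
        (fun (m : ℕ) (p : WithTop ℕ+ × ℂ) => ∑ k ∈ Finset.range m, (b p.1 k : ℂ) * p.2 ^ k)
        (fun p => F p.1 p.2) atTop (Set.univ ×ˢ Metric.closedBall (0 : ℂ) ρ)) ∧
      (∀ (n : ℕ+) (k : ℕ), k < (n : ℕ) → b n k = b ⊤ k) := by
  refine exists_limit_of_isBigO_sub (C := 2) kRadius_pos
    (fun (n : ℕ+) K => freeEnergy n (Complex.tanh K)) (fun n K hK => ?_)
    (fun n z hz => norm_freeEnergy_le (norm_tanh_lt (by simpa using hz))) (fun n x hx => ?_)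
    fun n m h => ?_
  · have hK' : ‖K‖ < kRadius := by simpa using hK
    have h1 := (hasDerivAt_freeEnergy (n := n) (norm_tanh_lt hK')).differentiableAt
    exact (h1.comp K (differentiableAt_tanh
      (cosh_ne_zero_of_abs_im_lt (abs_im_lt_of_norm_lt_kRadius hK')))).differentiableWithinAt
  · have h1 := norm_tanh_lt (K := x) (by simpa using hx)
    rw [← Complex.ofReal_tanh, Complex.norm_real] at h1
    rw [← Complex.ofReal_tanh]
    exact im_freeEnergy h1
  · have hc : Tendsto Complex.tanh (𝓝 0) (𝓝 0) := by
      have := (differentiableAt_tanh (K := 0) (by simp)).continuousAt.tendsto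
      simpa using this
    exact ((freeEnergy_sub_isBigO (n := (n : ℕ)) (m := (m : ℕ)) h).comp_tendsto hc).trans
      (tanh_isBigO.pow n)

end Main

end

end CubicIsing

theorem theorem3 :
    -- the thermodynamic limit of the reduced free energy exists
    (∀ β J : ℝ, |Real.tanh (β * J)| < CubicIsing.tRadius →
      Tendsto (fun n : ℕ+ => CubicIsing.reducedFreeEnergy n β J 0) atTop
        (𝓝 (CubicIsing.reducedFreeEnergy ⊤ β J 0))) ∧
    -- `F N`, `b N`: the reduced free energy and its coefficients in the variable `β J`;
    -- `G N`, `a N`: the same in the variable `t = tanh (β J)`; `N = ⊤` is the infinite system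
    ∃ (F G : WithTop ℕ+ → ℂ → ℂ) (b a : WithTop ℕ+ → ℕ → ℝ),
      (∀ N : WithTop ℕ+,
        (∀ β J : ℝ, |β * J| < CubicIsing.kRadius →
          (CubicIsing.reducedFreeEnergy N β J 0 : ℂ) = F N ((β * J : ℝ) : ℂ)) ∧
        (∀ β J : ℝ, |Real.tanh (β * J)| < CubicIsing.tRadius →
          (CubicIsing.reducedFreeEnergy N β J 0 : ℂ) = G N (Real.tanh (β * J) : ℂ)) ∧
        (∀ K : ℂ, ‖K‖ < CubicIsing.kRadius →
          ‖Complex.tanh K‖ < CubicIsing.tRadius ∧ F N K = G N (Complex.tanh K)) ∧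
        -- analyticity, with the lower bounds on the radii of convergence
        HasFPowerSeriesOnBall (F N)
          (FormalMultilinearSeries.ofScalars ℂ (fun k => (b N k : ℂ))) 0
          (ENNReal.ofReal CubicIsing.kRadius) ∧
        HasFPowerSeriesOnBall (G N)
          (FormalMultilinearSeries.ofScalars ℂ (fun k => (a N k : ℂ))) 0
          (ENNReal.ofReal CubicIsing.tRadius)) ∧
      -- for complex parameters, `F n` and `G n` are branches of `-(1 / N) log Z_N`
      (∀ (n : ℕ+) (β J : ℂ), ‖β * J‖ < CubicIsing.kRadius →
        Complex.exp (-((n : ℕ) : ℂ) ^ 3 * F n (β * J)) =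
          CubicIsing.partitionFunction n β J 0) ∧
      (∀ (n : ℕ+) (β J : ℂ), |(β * J).im| < Real.pi / 2 →
        ‖Complex.tanh (β * J)‖ < CubicIsing.tRadius →
        Complex.exp (-((n : ℕ) : ℂ) ^ 3 * G n (Complex.tanh (β * J))) =
          CubicIsing.partitionFunction n β J 0) ∧
      -- the series converge uniformly in the size of the system, the infinite one included
      (∀ ρ < CubicIsing.kRadius,
        TendstoUniformlyOn
          (fun (m : ℕ) (p : WithTop ℕ+ × ℂ) => ∑ k ∈ Finset.range m, (b p.1 k : ℂ) * p.2 ^ k)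
          (fun p => F p.1 p.2) atTop (Set.univ ×ˢ Metric.closedBall (0 : ℂ) ρ)) ∧
      (∀ ρ < CubicIsing.tRadius,
        TendstoUniformlyOn
          (fun (m : ℕ) (p : WithTop ℕ+ × ℂ) => ∑ k ∈ Finset.range m, (a p.1 k : ℂ) * p.2 ^ k)
          (fun p => G p.1 p.2) atTop (Set.univ ×ˢ Metric.closedBall (0 : ℂ) ρ)) ∧
      -- the coefficients of order less than `n` are those of the infinite system
      (∀ (n : ℕ+) (k : ℕ), k < (n : ℕ) → b n k = b ⊤ k ∧ a n k = a ⊤ k) := by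
  obtain ⟨G, a, hGn, hGlim, hGser, hGunif, hGcoef⟩ := CubicIsing.exists_freeEnergy_tanhSeries
  obtain ⟨F, b, hFn, hFlim, hFser, hFunif, hFcoef⟩ := CubicIsing.exists_freeEnergy_series
  have hlim : ∀ β J : ℝ, |Real.tanh (β * J)| < CubicIsing.tRadius →
      (CubicIsing.reducedFreeEnergy ⊤ β J 0 : ℂ) = G ⊤ (Real.tanh (β * J) : ℂ) ∧
      Tendsto (fun n : ℕ+ => CubicIsing.reducedFreeEnergy n β J 0) atTop
        (𝓝 (CubicIsing.reducedFreeEnergy ⊤ β J 0)) := by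
    intro β J h
    have h1 : Tendsto (fun n : ℕ+ => (CubicIsing.finiteReducedFreeEnergy n β J 0 : ℂ)) atTop
        (𝓝 (G ⊤ (Real.tanh (β * J) : ℂ))) := by
      simp only [CubicIsing.finiteReducedFreeEnergy_eq h]
      exact hGlim _ (by rwa [mem_ball_zero_iff, Complex.norm_real])
    have hre : Tendsto (fun n : ℕ+ => CubicIsing.finiteReducedFreeEnergy n β J 0) atTop
        (𝓝 (G ⊤ (Real.tanh (β * J) : ℂ)).re) := by
      exact (Complex.continuous_re.tendsto _).comp h1
    have htop : CubicIsing.reducedFreeEnergy ⊤ β J 0 = (G ⊤ (Real.tanh (β * J) : ℂ)).re :=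
      hre.limUnder_eq
    have h2 := (Complex.continuous_ofReal.tendsto _).comp hre
    refine ⟨?_, ?_⟩
    · rw [htop]
      exact tendsto_nhds_unique h2 h1
    · rw [htop]
      exact hre
  have htanh : ∀ (N : WithTop ℕ+) (K : ℂ), ‖K‖ < CubicIsing.kRadius →
      F N K = G N (Complex.tanh K) := by
    intro N K hK
    induction N using WithTop.recTopCoe with
    | top =>
      exact tendsto_nhds_unique (hFlim K (by simpa using hK))
        (hGlim _ (by simpa using CubicIsing.norm_tanh_lt hK))
    | coe n => rw [hFn, hGn]
  have hG : ∀ (N : WithTop ℕ+) (β J : ℝ), |Real.tanh (β * J)| < CubicIsing.tRadius →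
      (CubicIsing.reducedFreeEnergy N β J 0 : ℂ) = G N (Real.tanh (β * J) : ℂ) := by
    intro N β J h
    induction N using WithTop.recTopCoe with
    | top => exact (hlim β J h).1
    | coe n =>
      rw [hGn]
      exact CubicIsing.finiteReducedFreeEnergy_eq h
  refine ⟨fun β J h => (hlim β J h).2, F, G, b, a, fun N => ⟨fun β J h => ?_, hG N,
    fun K hK => ⟨CubicIsing.norm_tanh_lt hK, htanh N K hK⟩, hFser N, hGser N⟩,
    fun n β J h => ?_, fun n β J him h => ?_, hFunif, hGunif,
    fun n k hk => ⟨hFcoef n k hk, hGcoef n k hk⟩⟩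
  · have h1 : ‖((β * J : ℝ) : ℂ)‖ < CubicIsing.kRadius := by
      rw [Complex.norm_real]; exact h
    have h2 := CubicIsing.norm_tanh_lt h1
    rw [← Complex.ofReal_tanh, Complex.norm_real, Real.norm_eq_abs] at h2
    rw [htanh N _ h1, ← Complex.ofReal_tanh]
    exact hG N β J h2
  · rw [hFn]
    exact CubicIsing.exp_freeEnergy_tanh (CubicIsing.abs_im_lt_of_norm_lt_kRadius h)
      (CubicIsing.norm_tanh_lt h)
  · rw [hGn]
    exact CubicIsing.exp_freeEnergy_tanh him h
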